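/- Let $\Omega_{\mathrm O}\subset\mathbb R^d$ be a non-empty open strictly convex set (that is, $\Omega_{\mathrm O}$ is convex and $\partial\Omega_{\mathrm O}$ contains no non-degenerate segments), and let $\Omega_{\mathrm I}\subset\Omega_{\mathrm O}$ be a closed set. Assume that 1) the boundary of $\operatorname{conv}\Omega_{\mathrm I}$ does not contain rays; 2) the closure of $\operatorname{conv}\Omega_{\mathrm I}$ lies inside $\Omega_{\mathrm O}$; 3) $\Omega_{\mathrm O}$ and $\operatorname{conv}\Omega_{\mathrm I}$ have congruent maximal inscribed convex cones, and $\operatorname{int}\operatorname{conv}\Omega_{\mathrm I}\neq\varnothing$ (the one-point cone is allowed); 4) the family of connected components $\omega_j$ of $(\operatorname{int}\operatorname{conv}\Omega_{\mathrm I})\setminus\Omega_{\mathrm I}$ is locally finite: every bounded set meets only finitely many $\omega_j$; 5) for every $j$ there is a supporting hyperplane $L_j$ of $\operatorname{conv}\Omega_{\mathrm I}$ that contains $\partial\omega_j\setminus\Omega_{\mathrm I}$. Write $\langle\psi\rangle_J=|J|^{-1}\int_J\psi$ for the average over a non-degenerate interval $J$, and let $\boldsymbol A_\Omega$ be the class of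 all summable $\psi\colon[0,1]\to\mathbb R^d$ such that $\psi(x)\in\partial\Omega_{\mathrm O}$ for all $x\in[0,1]$ and $\langle\psi\rangle_J\notin\Omega_{\mathrm I}$ for every non-degenerate subinterval $J\subset[0,1]$. A function $G\colon W\to[-\infty,+\infty]$ on a set $W\subset\mathbb R^d$ is called locally concave if for every convex set $C\subset W$ the restriction $G|_C$ is concave, i.e. the set $\{(x,\mu)\in C\times\mathbb R:\ \mu\le G(x)\}$ is convex. For $W\supset\partial\Omega_{\mathrm O}$ and $f\colon\partial\Omega_{\mathrm O}\to\mathbb R$ put $$\mathfrak B_{W,f}(x)=\inf\{G(x):\ G\colon W\to[-\infty,+\infty]\ \text{locally concave},\ G=f\ \text{on}\ \partial\Omega_{\mathrm O}\},\qquad x\in W.$$ Let $\Omega_{\mathrm{conv}}=\operatorname{cl}\Omega_{\mathrm O}\setminus\operatorname{conv}\Omega_{\mathrm I}$ and $\overline\Omega_{\mathrm{conv}}=\operatorname{cl}\Omega_{\mathrm O}\setminus\operatorname{int}\operatorname{conv}\Omega_{\mathrm I}$. Theorem. Let $f\colon\partial\Omega_{\mathrm O}\to\mathbb R$ be continuous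 and bounded from below, and let $\psi\in\boldsymbol A_\Omega$ satisfy $\langle\psi\rangle_{[0,1]}\notin\operatorname{int}\operatorname{conv}\Omega_{\mathrm I}$. Then $$\langle f(\psi)\rangle_{[0,1]}\le\mathfrak B_{\overline\Omega_{\mathrm{conv}},f}(\langle\psi\rangle_{[0,1]}),$$ and if moreover $\langle\psi\rangle_{[0,1]}\notin\operatorname{conv}\Omega_{\mathrm I}$, then $$\langle f(\psi)\rangle_{[0,1]}\le\mathfrak B_{\Omega_{\mathrm{conv}},f}(\langle\psi\rangle_{[0,1]}).$$ Here the left-hand side is $+\infty$ if $f(\psi)$ is not summable; in particular, $f(\psi)$ is summable whenever the right-hand side is not $+\infty$. -/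

import Mathlib

namespace Bellman

/-- `p + K` is a cone with vertex `p` inscribed in `S`, for some `p`. -/
def IsInscribedCone {d : ℕ} (S : Set (EuclideanSpace ℝ (Fin d)))
    (K : PointedCone ℝ (EuclideanSpace ℝ (Fin d))) : Prop :=
  ∃ p, ∀ v ∈ K, p + v ∈ S

/-- A maximal inscribed cone of `S`, translated so that its vertex is the origin. -/
def IsMaximalInscribedCone {d : ℕ} (S : Set (EuclideanSpace ℝ (Fin d)))
    (K : PointedCone ℝ (EuclideanSpace ℝ (Fin d))) : Prop :=
  Maximal (IsInscribedCone S) K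

/-- The connected components of `int (conv F) \ F`. -/
def gapComponents {d : ℕ} (F : Set (EuclideanSpace ℝ (Fin d))) :
    Set (Set (EuclideanSpace ℝ (Fin d))) :=
  {ω | ∃ x ∈ interior (convexHull ℝ F) \ F,
    ω = connectedComponentIn (interior (convexHull ℝ F) \ F) x}

/-- The hyperplane `{y | l y = c}` is a supporting hyperplane of the set `C`. -/
def IsSupportingHyperplane {d : ℕ} (C : Set (EuclideanSpace ℝ (Fin d)))
    (l : EuclideanSpace ℝ (Fin d) →L[ℝ] ℝ) (c : ℝ) : Prop :=
  l ≠ 0 ∧ (∀ y ∈ C, l y ≤ c) ∧ ∃ y ∈ C, l y = c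

/-- The standing assumptions on the outer domain `ΩO` and the forbidden set `ΩI`. Strict convexity
of the open set `ΩO` means that its boundary contains no nondegenerate segment; since Mathlib's
`StrictConvex` says nothing about the boundary of an open set, it is applied to the closure. -/
structure AdmissiblePair {d : ℕ} (ΩO ΩI : Set (EuclideanSpace ℝ (Fin d))) : Prop where
  isOpen_outer : IsOpen ΩO
  nonempty_outer : ΩO.Nonempty
  convex_outer : Convex ℝ ΩO
  strictConvex_outer : StrictConvex ℝ (closure ΩO)
  isClosed_inner : IsClosed ΩI
  inner_subset_outer : ΩI ⊆ ΩO
  /-- 1) the boundary of `conv ΩI` contains no rays -/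
  no_rays : ∀ p v : EuclideanSpace ℝ (Fin d), v ≠ 0 →
    ¬ ∀ t : ℝ, 0 ≤ t → p + t • v ∈ frontier (convexHull ℝ ΩI)
  /-- 2) the closure of `conv ΩI` lies inside `ΩO` -/
  closure_subset : closure (convexHull ℝ ΩI) ⊆ ΩO
  /-- 3) `ΩO` and `conv ΩI` have congruent maximal inscribed cones -/
  congruent_cones : ∃ KO KI : PointedCone ℝ (EuclideanSpace ℝ (Fin d)),
    IsMaximalInscribedCone ΩO KO ∧ IsMaximalInscribedCone (convexHull ℝ ΩI) KI ∧
    ∃ U : EuclideanSpace ℝ (Fin d) ≃ₗᵢ[ℝ] EuclideanSpace ℝ (Fin d),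
      U '' (KO : Set (EuclideanSpace ℝ (Fin d))) = (KI : Set (EuclideanSpace ℝ (Fin d)))
  /-- 3), second part: `conv ΩI` has nonempty interior -/
  nonempty_interior : (interior (convexHull ℝ ΩI)).Nonempty
  /-- 4) the components of `int (conv ΩI) \ ΩI` form a locally finite family -/
  locallyFinite : ∀ B : Set (EuclideanSpace ℝ (Fin d)), Bornology.IsBounded B →
    {ω ∈ gapComponents ΩI | (ω ∩ B).Nonempty}.Finite
  /-- 5) for every component `ω`, the set `∂ω \ ΩI` lies in a supporting hyperplane of `conv ΩI` -/
  supporting : ∀ ω ∈ gapComponents ΩI, ∃ l c,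
    IsSupportingHyperplane (convexHull ℝ ΩI) l c ∧ ∀ y ∈ frontier ω \ ΩI, l y = c

/-- The class of summable functions on `[0,1]` with values in `∂ΩO` all of whose averages over
nondegenerate subintervals avoid `ΩI`. Values of `ψ` outside `[0,1]` play no role. -/
structure MemClassA {d : ℕ} (ΩO ΩI : Set (EuclideanSpace ℝ (Fin d)))
    (ψ : ℝ → EuclideanSpace ℝ (Fin d)) : Prop where
  integrableOn : MeasureTheory.IntegrableOn ψ (Set.Icc 0 1)
  mem_frontier : ∀ x ∈ Set.Icc (0 : ℝ) 1, ψ x ∈ frontier ΩO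
  average_notMem : ∀ a b : ℝ, 0 ≤ a → a < b → b ≤ 1 → (⨍ x in Set.Icc a b, ψ x) ∉ ΩI

/-- Concavity on `C` of a function with values in `[-∞, ∞]`: the part of its hypograph over `C`
is convex. -/
def ExtConcaveOn {d : ℕ} (C : Set (EuclideanSpace ℝ (Fin d)))
    (G : EuclideanSpace ℝ (Fin d) → EReal) : Prop :=
  Convex ℝ {p : EuclideanSpace ℝ (Fin d) × ℝ | p.1 ∈ C ∧ (p.2 : EReal) ≤ G p.1}

/-- `G` is locally concave on `W`: it is concave on every convex subset of `W`. -/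
def LocallyConcaveOn {d : ℕ} (W : Set (EuclideanSpace ℝ (Fin d)))
    (G : EuclideanSpace ℝ (Fin d) → EReal) : Prop :=
  ∀ C ⊆ W, Convex ℝ C → ExtConcaveOn C G

/-- The minimal locally concave function on `W` with values `f` on `∂ΩO`, as a pointwise infimum.
It is meaningful at the points of `W`. -/
noncomputable def minLocallyConcave {d : ℕ} (ΩO W : Set (EuclideanSpace ℝ (Fin d)))
    (f : EuclideanSpace ℝ (Fin d) → ℝ) (x : EuclideanSpace ℝ (Fin d)) : EReal :=
  sInf {y : EReal | ∃ G : EuclideanSpace ℝ (Fin d) → EReal,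
    LocallyConcaveOn W G ∧ (∀ z ∈ frontier ΩO, G z = (f z : EReal)) ∧ y = G x}

/-- The average over `[0,1]` of a measurable real function that is bounded from below; its value
is `∞` when the function is not summable. -/
noncomputable def extAverage (g : ℝ → ℝ) : EReal :=
  ((∫⁻ x in Set.Icc (0 : ℝ) 1, ENNReal.ofReal (g x) : ENNReal) : EReal) -
    ((∫⁻ x in Set.Icc (0 : ℝ) 1, ENNReal.ofReal (-g x) : ENNReal) : EReal)

end Bellman

open Set Filter Topology Metric MeasureTheory

namespace Bellman

/-! ### Convex geometry: supporting functionals, recession directions, chords of `ΩO` -/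

section
section General
variable {E : Type*} [NormedAddCommGroup E] [InnerProductSpace ℝ E]

/-! For `d ≥ 2` the core is a Bellman induction (`integral_le`). Let `G` be a competitor on `closure
ΩO \ interior (convexHull ℝ ΩI)`, let `φ` be a truncation of `f ∘ ψ`, and suppose the inequality
fails on `[0,1]`. Call an interval bad if it fails there by a fixed margin. A bad interval can be
cut so that the segment joining the averages of `ψ` over the two halves avoids the interior of the
hull (`exists_split`); concavity of `G` on this segment makes one half bad. Since `G` is lower
semicontinuous (`lsc`), badness survives nondegenerate limits, so bad intervals shrink to a point
`x` (`exists_shrinking_intervals`). If the averages of `ψ` tend to `ψ x`, lower semicontinuity at `ψ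
x ∈ ∂ΩO` contradicts the margin. A Vitali–Carathéodory majorant of `-φ`, with values prescribed on
the null set of other points, rules those out.

The cut exists because the parameters where the left half is an obstacle and those where the right
half is one form disjoint open sets; by connectedness, failure would make one side an obstacle for
all parameters. Then the average lies on a flat piece of the hull's boundary off `ΩI`, and moving
the interval's ends traps averages in one component of `interior (convexHull ℝ ΩI) \ ΩI` until they
converge to a value of `ψ` inside `ΩO`, which is absurd (`exists_left_avoiding`).

Lower semicontinuity follows from concavity and a lower bound, which chords parallel to supporting
hyperplanes carry over from `f`. Such chords are bounded because the cones of `ΩO` and the hull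
agree and the hull's boundary has no rays (`ray_transfer`). The delicate points are those of the
inner boundary (`lsc_inner_boundary`).

The estimate on the smaller domain follows from the one on the larger: a competitor off the hull
extends radially to the hull's boundary without losing local concavity
(`radialExtension_locallyConcaveOn`). For `d < 2` there are no chords, but `ψ` is constant almost
everywhere (`ae_eq_const`). -/

theorem le_on_closure_of_le_on_interior {F : Type*} [NormedAddCommGroup F] [NormedSpace ℝ F]
    {C : Set F} (hC : Convex ℝ C) (hi : (interior C).Nonempty)
    {l : F →L[ℝ] ℝ} {c : ℝ} (h : ∀ w ∈ interior C, l w ≤ c) : ∀ w ∈ closure C, l w ≤ c := by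
  rw [← hC.closure_interior_eq_closure_of_nonempty_interior hi]
  intro w hw
  exact closure_minimal (s := interior C) (t := {w | l w ≤ c}) h
    (isClosed_le l.continuous continuous_const) hw

theorem lt_on_interior_of_le {F : Type*} [NormedAddCommGroup F] [NormedSpace ℝ F] {C : Set F}
    {l : F →L[ℝ] ℝ} {c : ℝ} (hl : l ≠ 0) (h : ∀ w ∈ C, l w ≤ c) : ∀ w ∈ interior C, l w < c := by
  intro w hw
  obtain ⟨u, hu⟩ : ∃ u, l u ≠ 0 := by
    by_contra! h0
    exact hl (ContinuousLinearMap.ext h0)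
  have hlim : Tendsto (fun t : ℝ => w + (t * l u) • u) (𝓝[>] 0) (𝓝 w) := by
    have : Continuous (fun t : ℝ => w + (t * l u) • u) := by fun_prop
    have h2 := this.tendsto 0
    simp only [zero_mul, zero_smul, add_zero] at h2
    exact h2.mono_left nhdsWithin_le_nhds
  have h1 := hlim.eventually (mem_interior_iff_mem_nhds.1 hw)
  obtain ⟨t, ht, ht0⟩ := (h1.and self_mem_nhdsWithin).exists
  have h3 := h _ ht
  simp only [map_add, map_smul, smul_eq_mul] at h3
  have h4 : 0 < t * (l u * l u) := mul_pos ht0 (mul_self_pos.2 hu)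
  nlinarith

/-- For `y` on the boundary Hahn–Banach applies with `p = y`; off the closure, `p` is the nearest
point and `l` the normal there. The contact point `p` is kept because the no-ray condition is
applied at it. -/
theorem exists_supporting_functional [CompleteSpace E] {C : Set E} (hC : Convex ℝ C)
    (hi : (interior C).Nonempty) {y : E} (hy : y ∉ interior C) :
    ∃ (l : E →L[ℝ] ℝ) (p : E), l ≠ 0 ∧ p ∈ closure C ∧ (∀ w ∈ closure C, l w ≤ l p) ∧
      l p ≤ l y ∧ (y ∉ closure C → l p < l y) := by
  by_cases hyC : y ∈ closure C
  · obtain ⟨l, hl⟩ := geometric_hahn_banach_open_point hC.interior isOpen_interior hy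
    refine ⟨l, y, ?_, hyC, ?_, le_rfl, fun h => absurd hyC h⟩
    · rintro rfl
      obtain ⟨w, hw⟩ := hi
      simpa using hl w hw
    · exact le_on_closure_of_le_on_interior hC hi fun w hw => (hl w hw).le
  · have hne : (closure C).Nonempty := (hi.mono interior_subset).closure
    obtain ⟨p, hp, hpn⟩ := exists_norm_eq_iInf_of_complete_convex hne
      isClosed_closure.isComplete hC.closure y
    rw [norm_eq_iInf_iff_real_inner_le_zero hC.closure hp] at hpn
    have hyp : y - p ≠ 0 := by
      intro h
      rw [sub_eq_zero] at h
      exact hyC (h ▸ hp)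
    have hpos : 0 < inner ℝ (y - p) (y - p) := real_inner_self_pos.2 hyp
    have hlt : innerSL ℝ (y - p) p < innerSL ℝ (y - p) y := by
      simp only [innerSL_apply_apply]
      rw [inner_sub_right (y - p) y p] at hpos
      linarith
    refine ⟨innerSL ℝ (y - p), p, ?_, hp, ?_, hlt.le, fun _ => hlt⟩
    · intro h
      rw [h] at hlt
      simp at hlt
    · intro w hw
      have := hpn w hw
      rw [inner_sub_right] at this
      simp only [innerSL_apply_apply]
      linarith

/-- Chords from `q` to the far points `p + (t / s) • v` become parallel to `v` as `s → 0`. -/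
theorem ray_mem_of_ray_mem {F : Type*} [NormedAddCommGroup F] [NormedSpace ℝ F] {S : Set F}
    (hS : Convex ℝ S) (hSc : IsClosed S) {p q v : F} (hp : ∀ t : ℝ, 0 ≤ t → p + t • v ∈ S)
    (hq : q ∈ S) : ∀ t : ℝ, 0 ≤ t → q + t • v ∈ S := by
  intro t ht
  have hlim : Tendsto (fun s : ℝ => q + t • v + s • (p - q)) (𝓝[>] 0) (𝓝 (q + t • v)) := by
    have : Continuous (fun s : ℝ => q + t • v + s • (p - q)) := by fun_prop
    have h2 := this.tendsto 0
    simp only [zero_smul, add_zero] at h2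
    exact h2.mono_left nhdsWithin_le_nhds
  refine hSc.mem_of_tendsto hlim ?_
  have : Ioo (0 : ℝ) 1 ∈ 𝓝[>] (0 : ℝ) := Ioo_mem_nhdsGT one_pos
  filter_upwards [this] with s hs
  have hmem := hS hq (hp (t / s) (by have := hs.1; positivity)) (sub_nonneg.2 hs.2.le) hs.1.le
    (by ring)
  convert hmem using 1
  have h0 : s ≠ 0 := hs.1.ne'
  rw [smul_add, smul_smul, mul_div_cancel₀ _ h0]
  module

/-- Recurrence: the orbit stays in a compact ball, so two iterates are close, and the isometry
allows the smaller power to be cancelled. -/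
theorem exists_iterate_near {F : Type*} [NormedAddCommGroup F] [NormedSpace ℝ F]
    [FiniteDimensional ℝ F] (U : F ≃ₗᵢ[ℝ] F) (v : F) {ε : ℝ} (hε : 0 < ε) :
    ∃ n : ℕ, 0 < n ∧ dist ((U^[n]) v) v < ε := by
  have hnorm : ∀ n, (U^[n]) v ∈ closedBall (0 : F) ‖v‖ := by
    intro n
    rw [mem_closedBall_zero_iff]
    induction n with
    | zero => simp
    | succ k ih => rw [Function.iterate_succ_apply', U.norm_map]; exact ih
  have hprop : ProperSpace F := FiniteDimensional.proper ℝ F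
  obtain ⟨a, -, φ, hφ, hlim⟩ := (isCompact_closedBall (0 : F) ‖v‖).tendsto_subseq hnorm
  obtain ⟨N, hN⟩ := Metric.cauchySeq_iff.1 hlim.cauchySeq ε hε
  have h1 := hN (N + 1) (Nat.le_succ N) N le_rfl
  have h2 : φ N < φ (N + 1) := hφ (Nat.lt_succ_self N)
  refine ⟨φ (N + 1) - φ N, Nat.sub_pos_of_lt h2, ?_⟩
  have h3 : (U^[φ (N + 1)]) v = (U^[φ N]) ((U^[φ (N + 1) - φ N]) v) := by
    rw [← Function.iterate_add_apply, Nat.add_sub_cancel' h2.le]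
  have hiso : ∀ n, ∀ a b, dist ((U^[n]) a) ((U^[n]) b) = dist a b := by
    intro n
    induction n with
    | zero => simp
    | succ k ih => intro a b; rw [Function.iterate_succ_apply', Function.iterate_succ_apply',
        U.dist_map, ih]
  simp only [Function.comp] at h1
  rwa [h3, hiso] at h1

/-- A segment from an interior point of the closure to an outer point crosses the boundary. -/
theorem exists_exit {F : Type*} [NormedAddCommGroup F] [NormedSpace ℝ F] {S : Set F}
    {y u : F} (hy : y ∈ closure S) {η : ℝ} (hη : 0 ≤ η) (hout : y + η • u ∉ closure S)
    (hS : Convex ℝ S) :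
    ∃ t ∈ Ico (0 : ℝ) η, y + t • u ∈ frontier S ∧ segment ℝ y (y + t • u) ⊆ closure S := by
  let T := {t : ℝ | t ∈ Icc 0 η ∧ y + t • u ∈ closure S}
  have hcont : Continuous fun t : ℝ => y + t • u := by fun_prop
  have hT : IsCompact T := isCompact_Icc.inter_right (isClosed_closure.preimage hcont)
  have hne : T.Nonempty := ⟨0, ⟨le_rfl, hη⟩, by simpa using hy⟩
  obtain ⟨t, ⟨ht, htS⟩, hmax⟩ := hT.exists_isGreatest hne
  have htη : t < η := by
    refine lt_of_le_of_ne ht.2 ?_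
    rintro rfl
    exact hout htS
  refine ⟨t, ⟨ht.1, htη⟩, ⟨htS, fun hint => ?_⟩, hS.closure.segment_subset hy htS⟩
  have h1 : ∀ᶠ s in 𝓝 t, y + s • u ∈ interior S :=
    (hcont.tendsto t).eventually (isOpen_interior.mem_nhds hint)
  have h2 : ∀ᶠ s in 𝓝[>] t, y + s • u ∈ interior S := h1.filter_mono nhdsWithin_le_nhds
  obtain ⟨s, hs, hs1, hs2⟩ := (h2.and (Ioo_mem_nhdsGT htη)).exists
  exact absurd (hmax ⟨⟨ht.1.trans hs1.le, hs2.le⟩, subset_closure (interior_subset hs)⟩)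
    (not_le.2 hs1)

end General

variable {d : ℕ} {ΩO ΩI : Set (EuclideanSpace ℝ (Fin d))}

theorem IsInscribedCone.ray_mem_closure {S : Set (EuclideanSpace ℝ (Fin d))}
    {K : PointedCone ℝ (EuclideanSpace ℝ (Fin d))} (hS : Convex ℝ S) (hK : IsInscribedCone S K)
    {v p : EuclideanSpace ℝ (Fin d)} (hv : v ∈ closure (K : Set (EuclideanSpace ℝ (Fin d))))
    (hp : p ∈ closure S) : ∀ t : ℝ, 0 ≤ t → p + t • v ∈ closure S := by
  obtain ⟨q, hq⟩ := hK
  refine ray_mem_of_ray_mem hS.closure isClosed_closure (p := q) (fun t ht => ?_) hp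
  have hc : Continuous fun v : EuclideanSpace ℝ (Fin d) => q + t • v := by fun_prop
  refine map_mem_closure (f := fun v => q + t • v) hc hv fun w hw => hq _ ?_
  exact K.smul_mem ht hw

/-- Adjoining `v` keeps the cone inscribed: `p + k + a • v` is the midpoint of `p + k`, in the open
set `S`, and `p + k + 2a • v`, in its closure. Maximality then gives `v ∈ K`. -/
theorem IsMaximalInscribedCone.mem_of_ray {S : Set (EuclideanSpace ℝ (Fin d))}
    {K : PointedCone ℝ (EuclideanSpace ℝ (Fin d))} (hS : Convex ℝ S) (hSo : IsOpen S)
    (hK : IsMaximalInscribedCone S K) {v y : EuclideanSpace ℝ (Fin d)}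
    (hv : ∀ t : ℝ, 0 ≤ t → y + t • v ∈ closure S) : v ∈ K := by
  have hins : IsInscribedCone S (K ⊔ Submodule.span {c : ℝ // 0 ≤ c} {v}) := by
    obtain ⟨p, hp⟩ := hK.prop
    refine ⟨p, fun w hw => ?_⟩
    obtain ⟨k, hk, z, hz, rfl⟩ := Submodule.mem_sup.1 hw
    obtain ⟨a, rfl⟩ := Submodule.mem_span_singleton.1 hz
    have h1 : p + k ∈ S := hp k hk
    have h2 : p + k + ((2 : ℝ) * a) • v ∈ closure S :=
      ray_mem_of_ray_mem hS.closure isClosed_closure hv (subset_closure h1) _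
        (mul_nonneg zero_le_two a.2)
    have h3 := hS.combo_interior_closure_mem_interior (hSo.interior_eq.symm ▸ h1) h2
      (a := 1 / 2) (b := 1 / 2) (by norm_num) (by norm_num) (by norm_num)
    rw [hSo.interior_eq] at h3
    convert h3 using 1
    change p + (k + (a : ℝ) • v) = _
    module
  exact hK.le_of_ge hins le_sup_left
    (Submodule.mem_sup_right (Submodule.mem_span_singleton_self v))

namespace AdmissiblePair

/-- Since `KI ⊆ KO` and `U` carries `KO` onto `KI`, every positive iterate of `U` sends `v ∈ KO`
into `KI`. By recurrence `v ∈ closure KI`, so `v` is a recession direction of the closed hull. -/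
theorem ray_transfer (h : AdmissiblePair ΩO ΩI) {y v p : EuclideanSpace ℝ (Fin d)}
    (hv : ∀ t : ℝ, 0 ≤ t → y + t • v ∈ closure ΩO) (hp : p ∈ closure (convexHull ℝ ΩI)) :
    ∀ t : ℝ, 0 ≤ t → p + t • v ∈ closure (convexHull ℝ ΩI) := by
  obtain ⟨KO, KI, hO, hI, U, hU⟩ := h.congruent_cones
  have hvO : v ∈ KO := hO.mem_of_ray h.convex_outer h.isOpen_outer hv
  have hsub : ∀ w ∈ KI, w ∈ KO := by
    intro w hw
    obtain ⟨q, hq⟩ := hI.prop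
    refine hO.mem_of_ray h.convex_outer h.isOpen_outer (y := q) fun t ht => ?_
    exact closure_mono h.closure_subset (subset_closure (subset_closure
      (hq _ (KI.smul_mem ht hw))))
  have hUm : ∀ w ∈ KO, U w ∈ KI := by
    intro w hw
    have : U w ∈ U '' (KO : Set (EuclideanSpace ℝ (Fin d))) := mem_image_of_mem _ hw
    rw [hU] at this
    exact this
  have hiter : ∀ n : ℕ, (U^[n]) v ∈ KO := by
    intro n
    induction n with
    | zero => exact hvO
    | succ k ih => rw [Function.iterate_succ_apply']; exact hsub _ (hUm _ ih)
  have hcl : v ∈ closure (KI : Set (EuclideanSpace ℝ (Fin d))) := by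
    rw [Metric.mem_closure_iff]
    intro ε hε
    obtain ⟨n, hn, hd⟩ := exists_iterate_near U v hε
    refine ⟨(U^[n]) v, ?_, by rwa [dist_comm]⟩
    obtain ⟨k, rfl⟩ := Nat.exists_eq_succ_of_ne_zero hn.ne'
    rw [Function.iterate_succ_apply']
    exact hUm _ (hiter k)
  exact hI.prop.ray_mem_closure (convex_convexHull ℝ ΩI) hcl hp

theorem mem_frontier_of_eq (_h : AdmissiblePair ΩO ΩI)
    {l : EuclideanSpace ℝ (Fin d) →L[ℝ] ℝ} {c : ℝ} (hl : l ≠ 0)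
    (hle : ∀ w ∈ closure (convexHull ℝ ΩI), l w ≤ c) {p : EuclideanSpace ℝ (Fin d)}
    (hp : p ∈ closure (convexHull ℝ ΩI)) (hpc : l p = c) : p ∈ frontier (convexHull ℝ ΩI) :=
  ⟨hp, fun hi => (lt_on_interior_of_le hl (fun w hw => hle w (subset_closure hw)) p hi).ne hpc⟩

/-- Otherwise the ray transfers to one from the contact point `p`, inside both the closed hull and
its supporting hyperplane, hence inside the frontier. -/
theorem exists_notMem_closure (h : AdmissiblePair ΩO ΩI)
    {l : EuclideanSpace ℝ (Fin d) →L[ℝ] ℝ} {p u : EuclideanSpace ℝ (Fin d)} (hl : l ≠ 0)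
    (hle : ∀ w ∈ closure (convexHull ℝ ΩI), l w ≤ l p) (hp : p ∈ closure (convexHull ℝ ΩI))
    (hu : u ≠ 0) (hlu : l u = 0) (y : EuclideanSpace ℝ (Fin d)) :
    ∃ t : ℝ, 0 ≤ t ∧ y + t • u ∉ closure ΩO := by
  by_contra! hray
  refine h.no_rays p u hu fun t ht => ?_
  exact h.mem_frontier_of_eq hl hle (h.ray_transfer hray hp t ht) (by simp [hlu])

theorem exists_chord (h : AdmissiblePair ΩO ΩI)
    {l : EuclideanSpace ℝ (Fin d) →L[ℝ] ℝ} {p u : EuclideanSpace ℝ (Fin d)} (hl : l ≠ 0)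
    (hle : ∀ w ∈ closure (convexHull ℝ ΩI), l w ≤ l p) (hp : p ∈ closure (convexHull ℝ ΩI))
    (hu : u ≠ 0) (hlu : l u = 0) {y : EuclideanSpace ℝ (Fin d)} (hy : y ∈ closure ΩO) :
    ∃ s t : ℝ, 0 ≤ s ∧ 0 ≤ t ∧ y + t • u ∈ frontier ΩO ∧ y + s • (-u) ∈ frontier ΩO := by
  obtain ⟨η, hη, hout⟩ := h.exists_notMem_closure hl hle hp hu hlu y
  obtain ⟨η', hη', hout'⟩ := h.exists_notMem_closure hl hle hp (neg_ne_zero.2 hu)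
    (by simp [hlu]) y
  obtain ⟨t, ht, hf, -⟩ := exists_exit hy hη hout h.convex_outer
  obtain ⟨s, hs, hf', -⟩ := exists_exit hy hη' hout' h.convex_outer
  exact ⟨s, t, hs.1, ht.1, hf, hf'⟩

theorem eq_of_mem_segment_frontier (h : AdmissiblePair ΩO ΩI) {a b z : EuclideanSpace ℝ (Fin d)}
    (ha : a ∈ closure ΩO) (hb : b ∈ closure ΩO) (hz : z ∈ openSegment ℝ a b)
    (hzf : z ∈ frontier ΩO) : a = b := by
  by_contra hab
  have := h.strictConvex_outer.openSegment_subset ha hb hab hz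
  rw [h.convex_outer.interior_closure_eq_interior_of_nonempty_interior
    (by rw [h.isOpen_outer.interior_eq]; exact h.nonempty_outer)] at this
  exact hzf.2 this

end AdmissiblePair

end

/-! ### Slices of convex sets, and lower bounds for locally concave functions -/

section
section General
variable {E : Type*} [NormedAddCommGroup E] [NormedSpace ℝ E]

theorem mem_segment_add_smul {y u : E} {s t : ℝ} (hs : 0 ≤ s) (ht : 0 ≤ t) :
    y ∈ segment ℝ (y + t • u) (y + s • (-u)) := by
  rcases (add_nonneg hs ht).eq_or_lt with h | h
  · have h1 : s = 0 := by linarith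
    have h2 : t = 0 := by linarith
    subst h1 h2
    simp
  · refine ⟨s / (s + t), t / (s + t), by positivity, by positivity, by field_simp, ?_⟩
    rw [smul_add, smul_add, smul_smul, smul_smul, smul_neg]
    have h1 : s / (s + t) * t = t / (s + t) * s := by ring
    have h2 : s / (s + t) + t / (s + t) = 1 := by field_simp
    rw [h1]
    calc _ = (s / (s + t) + t / (s + t)) • y := by module
      _ = y := by rw [h2, one_smul]

/-- Finds a line through `x` whose nearby points are easy for lower semicontinuity: off `C`, or
relatively interior to a flat slice. If the slice has interior in the hyperplane, `u` is a nonzero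
interior vector; if not, `u` is any vector off its span. -/
theorem exists_ker_direction [FiniteDimensional ℝ E] {C : Set E} (hC : Convex ℝ C) {x : E}
    (hx : x ∈ C) (l : E →L[ℝ] ℝ) (hker : ∃ u ≠ 0, l u = 0) :
    ∃ u, u ≠ 0 ∧ l u = 0 ∧ ∃ η₀ > 0, ∀ η ∈ Ioo (0 : ℝ) η₀, ∀ v ∈ ({u, -u} : Set E),
      x + η • v ∉ C ∨ ∃ ρ > 0, ball (x + η • v) ρ ∩ {y | l y = l (x + η • v)} ⊆ C := by
  let K := LinearMap.ker (l : E →ₗ[ℝ] ℝ)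
  let S : Set K := {v | x + (v : E) ∈ C}
  have hS : Convex ℝ S := by
    intro a ha b hb p q hp hq hpq
    have := hC ha hb hp hq hpq
    change x + ((p • a + q • b : K) : E) ∈ C
    convert this using 1
    push_cast
    calc x + (p • (a : E) + q • (b : E)) = (p + q) • x + (p • (a : E) + q • (b : E)) := by
          rw [hpq, one_smul]
      _ = _ := by module
  have h0 : (0 : K) ∈ S := by simpa [S] using hx
  obtain ⟨u₀, hu₀, hlu₀⟩ := hker
  have hnt : Nontrivial K := ⟨⟨⟨u₀, hlu₀⟩, 0, fun h => hu₀ (congrArg Subtype.val h)⟩⟩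
  by_cases hi : (interior S).Nonempty
  · have hgood : ∀ v ∈ interior S,
        ∃ ρ > 0, ball (x + (v : E)) ρ ∩ {y | l y = l (x + (v : E))} ⊆ C := by
      intro v hv
      obtain ⟨ρ, hρ, hb⟩ := Metric.isOpen_iff.1 isOpen_interior v hv
      refine ⟨ρ, hρ, fun y ⟨hy1, hy2⟩ => ?_⟩
      have hmem : l (y - x) = 0 := by
        have : l (v : E) = 0 := v.2
        rw [map_sub, hy2, map_add, this]
        ring
      have h3 : (⟨y - x, hmem⟩ : K) ∈ ball v ρ := by
        rw [mem_ball, Subtype.dist_eq, dist_eq_norm] at *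
        convert hy1 using 2
        simp only
        abel
      have h5 : (⟨y - x, hmem⟩ : K) ∈ S := interior_subset (hb h3)
      have h4 : x + (y - x) ∈ C := h5
      simpa using h4
    obtain ⟨u, hu, hune⟩ : ∃ u ∈ interior S, u ≠ 0 := by
      by_contra! hcon
      obtain ⟨w, hw⟩ := hi
      have hw0 := hcon w hw
      have : interior S = {0} := Subset.antisymm (fun a ha => hcon a ha) (by simpa [hw0] using hw)
      have hop : IsOpen ({0} : Set K) := this ▸ isOpen_interior
      have hbot := (inferInstance : (𝓝[≠] (0 : K)).NeBot)
      rw [isOpen_singleton_iff_punctured_nhds] at hop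
      exact hbot.ne hop
    refine ⟨u, fun h => hune (Subtype.ext h), u.2, ?_⟩
    have hpos : ∀ η ∈ Ioo (0 : ℝ) 1, η • u ∈ interior S := by
      intro η hη
      have := hS.combo_self_interior_mem_interior h0 hu (a := 1 - η) (b := η)
        (by linarith [hη.2]) hη.1 (by ring)
      simpa using this
    -- If `-(η₁ • u) ∈ S`, the vectors `-(η • u)` with `η < η₁` lie between it and the interior
    -- vector `u`; if no such `η₁` exists, the backward ray misses `S`.
    by_cases hneg : ∃ η₁ > (0 : ℝ), -(η₁ • u) ∈ S
    · obtain ⟨η₁, hη₁, hmem⟩ := hneg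
      refine ⟨min 1 η₁, lt_min one_pos hη₁, fun η hη v hv => Or.inr ?_⟩
      have h1 : η < 1 := lt_of_lt_of_le hη.2 (min_le_left _ _)
      have h2 : η < η₁ := lt_of_lt_of_le hη.2 (min_le_right _ _)
      rcases hv with rfl | rfl
      · exact hgood (η • u) (hpos η ⟨hη.1, h1⟩)
      · have hθ : 0 < (η₁ - η) / (η₁ + 1) := div_pos (sub_pos.2 h2) (by linarith)
        have h3 := hS.combo_self_interior_mem_interior hmem hu
          (a := (η + 1) / (η₁ + 1)) (b := (η₁ - η) / (η₁ + 1))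
          (by have := hη.1; positivity) hθ (by field_simp; ring)
        have h4 : ((η + 1) / (η₁ + 1)) • -(η₁ • u) + ((η₁ - η) / (η₁ + 1)) • u = -(η • u) := by
          rw [smul_neg, smul_smul, ← neg_smul, ← add_smul, ← neg_smul]
          congr 1
          field_simp
          ring
        rw [h4] at h3
        have := hgood _ h3
        simpa using this
    · push Not at hneg
      refine ⟨1, one_pos, fun η hη v hv => ?_⟩
      rcases hv with rfl | rfl
      · exact Or.inr (hgood (η • u) (hpos η hη))
      · refine Or.inl fun hmem => hneg η hη.1 ?_
        change x + ((-(η • u) : K) : E) ∈ C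
        simpa using hmem
  · rw [hS.interior_nonempty_iff_affineSpan_eq_top] at hi
    have hspan : Submodule.span ℝ S ≠ ⊤ := by
      intro htop
      apply hi
      rw [← insert_eq_of_mem h0]
      apply SetLike.coe_injective
      rw [affineSpan_insert_zero, htop]
      rfl
    obtain ⟨u, hu⟩ : ∃ u, u ∉ Submodule.span ℝ S := by
      by_contra! hcon
      exact hspan (Submodule.eq_top_iff'.2 hcon)
    have hune : (u : E) ≠ 0 := fun h => hu (by
      rw [show u = 0 from Subtype.ext h]; exact Submodule.zero_mem _)
    refine ⟨u, hune, u.2, 1, one_pos, fun η hη v hv => Or.inl fun hmem => hu ?_⟩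
    rcases hv with rfl | rfl
    · have h1 : η • u ∈ S := hmem
      exact (Submodule.smul_mem_iff _ hη.1.ne').1 (Submodule.subset_span h1)
    · have h1 : η • (-u) ∈ S := hmem
      exact neg_mem_iff.1 ((Submodule.smul_mem_iff _ hη.1.ne').1 (Submodule.subset_span h1))

end General

variable {d : ℕ} {ΩO ΩI W : Set (EuclideanSpace ℝ (Fin d))}
  {G : EuclideanSpace ℝ (Fin d) → EReal}

theorem LocallyConcaveOn.combo_le (hG : LocallyConcaveOn W G) {q z : EuclideanSpace ℝ (Fin d)}
    (hseg : segment ℝ q z ⊆ W) {μ ν a b : ℝ} (hμ : (μ : EReal) ≤ G q) (hν : (ν : EReal) ≤ G z)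
    (ha : 0 ≤ a) (hb : 0 ≤ b) (hab : a + b = 1) :
    ((a * μ + b * ν : ℝ) : EReal) ≤ G (a • q + b • z) := by
  have h := hG _ hseg (convex_segment q z)
  exact (h (x := (q, μ)) ⟨left_mem_segment ℝ q z, hμ⟩ (y := (z, ν))
    ⟨right_mem_segment ℝ q z, hν⟩ ha hb hab).2

theorem LocallyConcaveOn.le_of_mem_segment (hG : LocallyConcaveOn W G)
    {q z y : EuclideanSpace ℝ (Fin d)} (hseg : segment ℝ q z ⊆ W) {μ : ℝ}
    (hμ : (μ : EReal) ≤ G q) (hν : (μ : EReal) ≤ G z) (hy : y ∈ segment ℝ q z) :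
    (μ : EReal) ≤ G y := by
  obtain ⟨a, b, ha, hb, hab, rfl⟩ := hy
  have := hG.combo_le hseg hμ hν ha hb hab
  rwa [← add_mul, hab, one_mul] at this

/-- Lower semicontinuity at `q` relative to `W`, in terms of real lower bounds. -/
def LscAt (W : Set (EuclideanSpace ℝ (Fin d))) (G : EuclideanSpace ℝ (Fin d) → EReal)
    (q : EuclideanSpace ℝ (Fin d)) : Prop :=
  ∀ c : ℝ, (c : EReal) < G q → ∀ᶠ y in 𝓝[W] q, (c : EReal) ≤ G y

/-- When the segment from `q` to `y` extends beyond `y` by the factor `1 / s` inside `W`, concavity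
bounds `G y` below by weight `1 - s` on a value near `G q` and weight `s` on `m`. -/
theorem LocallyConcaveOn.lsc_of_star (hG : LocallyConcaveOn W G) {m : ℝ}
    (hm : ∀ y ∈ W, (m : EReal) ≤ G y) {q : EuclideanSpace ℝ (Fin d)}
    {F : Filter (EuclideanSpace ℝ (Fin d))}
    (hstar : ∀ s ∈ Ioo (0 : ℝ) 1, ∀ᶠ y in F, segment ℝ q (q + s⁻¹ • (y - q)) ⊆ W)
    {c : ℝ} (hc : (c : EReal) < G q) : ∀ᶠ y in F, (c : EReal) ≤ G y := by
  obtain ⟨c', hcc', hc'⟩ := EReal.lt_iff_exists_real_btwn.1 hc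
  have hcc : c < c' := EReal.coe_lt_coe_iff.1 hcc'
  have hden : 0 < |c' - m| + (c' - c) + 1 := by positivity
  -- Small enough that replacing the share `s` of `c'` by `m` still leaves at least `c`; the `+ 1`
  -- keeps the denominator above the numerator.
  set s := (c' - c) / (|c' - m| + (c' - c) + 1) with hs
  have hs0 : 0 < s := div_pos (sub_pos.2 hcc) hden
  have hs1 : s < 1 := by
    rw [hs, div_lt_one hden]
    linarith [abs_nonneg (c' - m)]
  have hval : c ≤ (1 - s) * c' + s * m := by
    have h1 : s * (|c' - m| + (c' - c) + 1) = c' - c := div_mul_cancel₀ _ hden.ne'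
    have h2 : s * (c' - m) ≤ s * |c' - m| := mul_le_mul_of_nonneg_left (le_abs_self _) hs0.le
    have h3 : 0 < s * (c' - c) := mul_pos hs0 (sub_pos.2 hcc)
    linarith
  filter_upwards [hstar s ⟨hs0, hs1⟩] with y hy
  have h := hG.combo_le hy hc'.le (hm _ (hy (right_mem_segment ℝ _ _)))
    (sub_nonneg.2 hs1.le) hs0.le (by ring)
  have h2 : (1 - s) • q + s • (q + s⁻¹ • (y - q)) = y := by
    rw [smul_add, smul_smul, mul_inv_cancel₀ hs0.ne']
    module
  rw [h2] at h
  exact le_trans (EReal.coe_le_coe_iff.2 hval) h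

theorem LocallyConcaveOn.lsc_halfspace (hG : LocallyConcaveOn W G) {m : ℝ}
    (hm : ∀ y ∈ W, (m : EReal) ≤ G y) {q : EuclideanSpace ℝ (Fin d)}
    (l : EuclideanSpace ℝ (Fin d) →L[ℝ] ℝ) {r : ℝ} (hr : 0 < r)
    (hW : ball q r ∩ {y | l q ≤ l y} ⊆ W)
    {c : ℝ} (hc : (c : EReal) < G q) : ∀ᶠ y in 𝓝[{y | l q ≤ l y}] q, (c : EReal) ≤ G y := by
  refine hG.lsc_of_star hm (fun s hs => ?_) hc
  have hlim : Tendsto (fun y => q + s⁻¹ • (y - q)) (𝓝 q) (𝓝 q) := by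
    have : Continuous fun y => q + s⁻¹ • (y - q) := by fun_prop
    simpa using this.tendsto q
  filter_upwards [nhdsWithin_le_nhds (hlim.eventually (ball_mem_nhds q hr)),
    self_mem_nhdsWithin] with y hy hly
  have hconv : Convex ℝ (ball q r ∩ {y | l q ≤ l y}) :=
    (convex_ball q r).inter (convex_halfSpace_ge l.isLinear _)
  refine (hconv.segment_subset ⟨mem_ball_self hr, le_refl (l q)⟩ ⟨hy, ?_⟩).trans hW
  simp only [mem_ofPred_eq, map_add, map_smul, map_sub, smul_eq_mul] at hly ⊢
  have := mul_nonneg (inv_nonneg.2 hs.1.le) (sub_nonneg.2 hly)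
  linarith

namespace AdmissiblePair

theorem exists_ker_ne_zero (hd : 2 ≤ d) (l : EuclideanSpace ℝ (Fin d) →L[ℝ] ℝ) :
    ∃ u ≠ 0, l u = 0 := by
  have h : LinearMap.ker (l : EuclideanSpace ℝ (Fin d) →ₗ[ℝ] ℝ) ≠ ⊥ :=
    LinearMap.ker_ne_bot_of_finrank_lt (by simp; omega)
  obtain ⟨u, hu, hne⟩ := Submodule.exists_mem_ne_zero_of_ne_bot h
  exact ⟨u, hne, hu⟩

/-- Every point of the domain lies on a chord that avoids the inner set. -/
theorem exists_chord_through (h : AdmissiblePair ΩO ΩI) (hd : 2 ≤ d)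
    {y : EuclideanSpace ℝ (Fin d)} (hy : y ∈ closure ΩO)
    (hyi : y ∉ interior (convexHull ℝ ΩI)) :
    ∃ a ∈ frontier ΩO, ∃ b ∈ frontier ΩO, y ∈ segment ℝ a b ∧
      segment ℝ a b ⊆ closure ΩO \ interior (convexHull ℝ ΩI) ∧
      (y ∉ closure (convexHull ℝ ΩI) →
        segment ℝ a b ⊆ closure ΩO \ convexHull ℝ ΩI) := by
  obtain ⟨l, p, hl, hp, hle, hpy, hlt⟩ :=
    exists_supporting_functional (convex_convexHull ℝ ΩI) h.nonempty_interior hyi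
  obtain ⟨u, hu, hlu⟩ := exists_ker_ne_zero hd l
  obtain ⟨s, t, hs, ht, hfa, hfb⟩ := h.exists_chord hl hle hp hu hlu hy
  have hcl : segment ℝ (y + t • u) (y + s • (-u)) ⊆ closure ΩO :=
    h.convex_outer.closure.segment_subset hfa.1 hfb.1
  -- The chord is parallel to the supporting hyperplane, so `l` stays at the value `l y`, which is
  -- at least its maximum on the hull.
  have hlseg : ∀ z ∈ segment ℝ (y + t • u) (y + s • (-u)), l z = l y := by
    rintro z ⟨a, b, -, -, hab, rfl⟩
    simp only [map_add, map_smul, smul_eq_mul, hlu, map_neg]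
    linear_combination (l y) * hab
  refine ⟨_, hfa, _, hfb, mem_segment_add_smul hs ht, fun z hz => ⟨hcl hz, fun hi => ?_⟩,
    fun hyc z hz => ⟨hcl hz, fun hc => ?_⟩⟩
  · have := lt_on_interior_of_le hl (fun w hw => hle w (subset_closure hw)) z hi
    rw [hlseg z hz] at this
    linarith
  · have := hle z (subset_closure hc)
    rw [hlseg z hz] at this
    linarith [hlt hyc]

theorem lower_bound (h : AdmissiblePair ΩO ΩI) (hd : 2 ≤ d)
    (hG : LocallyConcaveOn (closure ΩO \ interior (convexHull ℝ ΩI)) G) {m : ℝ}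
    (hm : ∀ z ∈ frontier ΩO, (m : EReal) ≤ G z) :
    ∀ y ∈ closure ΩO \ interior (convexHull ℝ ΩI), (m : EReal) ≤ G y := by
  rintro y ⟨hy, hyi⟩
  obtain ⟨a, ha, b, hb, hyab, hseg, -⟩ := h.exists_chord_through hd hy hyi
  exact hG.le_of_mem_segment hseg (hm a ha) (hm b hb) hyab

theorem lower_bound_of_isClosed (h : AdmissiblePair ΩO ΩI) (hd : 2 ≤ d)
    (hC : IsClosed (convexHull ℝ ΩI))
    (hG : LocallyConcaveOn (closure ΩO \ convexHull ℝ ΩI) G) {m : ℝ}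
    (hm : ∀ z ∈ frontier ΩO, (m : EReal) ≤ G z) :
    ∀ y ∈ closure ΩO \ convexHull ℝ ΩI, (m : EReal) ≤ G y := by
  rintro y ⟨hy, hyi⟩
  obtain ⟨a, ha, b, hb, hyab, -, hseg⟩ :=
    h.exists_chord_through hd hy (fun hi => hyi (interior_subset hi))
  rw [hC.closure_eq] at hseg
  exact hG.le_of_mem_segment (hseg hyi) (hm a ha) (hm b hb) hyab

end AdmissiblePair

end

/-! ### Lower semicontinuity of locally concave functions -/

section
section General
variable {E : Type*} [NormedAddCommGroup E] [NormedSpace ℝ E]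

/-- Near a relative interior point of a facet, every point below the facet is interior. -/
theorem eventually_le_of_facet {C : Set E} (hC : Convex ℝ C) (hi : (interior C).Nonempty)
    {l : E →L[ℝ] ℝ} (hl : l ≠ 0) {q : E} (hle : ∀ w ∈ closure C, l w ≤ l q) {ρ : ℝ} (hρ : 0 < ρ)
    (hfacet : ball q ρ ∩ {y | l y = l q} ⊆ closure C) :
    ∀ᶠ y in 𝓝 q, y ∉ interior C → l q ≤ l y := by
  obtain ⟨w, hw⟩ := hi
  have hlw : l w < l q := lt_on_interior_of_le hl (fun z hz => hle z (subset_closure hz)) w hw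
  have hpos : 0 < l q - l w := sub_pos.2 hlw
  let s : E → ℝ := fun y => (l q - l y) / (l q - l w)
  have hs : ContinuousAt s q := by
    have : Continuous s := by fun_prop
    exact this.continuousAt
  have hs0 : s q = 0 := by simp [s]
  have hlt : ∀ᶠ y in 𝓝 q, s y < 1 := hs.eventually (gt_mem_nhds (by rw [hs0]; exact one_pos))
  -- The projection of `y` from the interior point `w` onto the hyperplane of the facet: `y = (1 - s
  -- y) • g y + s y • w`.
  let g : E → E := fun y => (1 - s y)⁻¹ • (y - s y • w)
  have hg : ContinuousAt g q := by
    refine ContinuousAt.smul ((continuousAt_const.sub hs).inv₀ (by simp [hs0])) ?_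
    exact continuousAt_id.sub (hs.smul continuousAt_const)
  have hgq : g q = q := by simp [g, hs0]
  have hball : ∀ᶠ y in 𝓝 q, g y ∈ ball q ρ :=
    hg.eventually (by rw [hgq]; exact ball_mem_nhds q hρ)
  filter_upwards [hlt, hball] with y hy1 hy2 hyi
  by_contra! hlow
  have hsy : 0 < s y := div_pos (sub_pos.2 hlow) hpos
  have h1 : 1 - s y ≠ 0 := by linarith
  have hlg : l (g y) = l q := by
    have h2 : s y * (l q - l w) = l q - l y := div_mul_cancel₀ _ hpos.ne'
    simp only [g, map_smul, map_sub, smul_eq_mul]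
    rw [inv_mul_eq_iff_eq_mul₀ h1]
    linarith
  have := hC.combo_closure_interior_mem_interior (hfacet ⟨hy2, hlg⟩) hw
    (a := 1 - s y) (b := s y) (by linarith) hsy (by ring)
  rw [show (1 - s y) • g y = y - s y • w by simp [g, smul_smul, h1]] at this
  simp only [sub_add_cancel] at this
  exact hyi this

end General

variable {d : ℕ} {ΩO ΩI : Set (EuclideanSpace ℝ (Fin d))}
  {G : EuclideanSpace ℝ (Fin d) → EReal}

namespace AdmissiblePair

theorem isOpen_outer_mem_nhds (h : AdmissiblePair ΩO ΩI) {q : EuclideanSpace ℝ (Fin d)}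
    (hq : q ∈ ΩO) : ∃ r > 0, ball q r ⊆ ΩO :=
  Metric.isOpen_iff.1 h.isOpen_outer q hq

/-- Lower semicontinuity at a point of the outer domain off the closed inner hull. -/
theorem lsc_of_ball {W : Set (EuclideanSpace ℝ (Fin d))} (hG : LocallyConcaveOn W G) {m : ℝ}
    (hm : ∀ y ∈ W, (m : EReal) ≤ G y) {q : EuclideanSpace ℝ (Fin d)} (hq : W ∈ 𝓝 q) :
    ∀ c : ℝ, (c : EReal) < G q → ∀ᶠ y in 𝓝 q, (c : EReal) ≤ G y := by
  intro c hc
  obtain ⟨r, hr, hrW⟩ := Metric.mem_nhds_iff.1 hq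
  have := hG.lsc_halfspace hm 0 hr (fun y hy => hrW hy.1) hc
  simpa using this

/-- By strict convexity `q ± η • u` lies outside `closure ΩO` for a tangent direction `u`. Hence the
line parallel to `u` through a point `y` near `q` meets `∂ΩO` on both sides of `y`, close to `q`,
where `f > c`; concavity on this short chord bounds `G y`. -/
theorem lsc_frontier (h : AdmissiblePair ΩO ΩI) (hd : 2 ≤ d)
    {W : Set (EuclideanSpace ℝ (Fin d))} (hW : W ⊆ closure ΩO)
    (hW' : closure ΩO \ closure (convexHull ℝ ΩI) ⊆ W)
    (hG : LocallyConcaveOn W G) {f : EuclideanSpace ℝ (Fin d) → ℝ}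
    (hf : ContinuousOn f (frontier ΩO)) (hGf : ∀ z ∈ frontier ΩO, G z = (f z : EReal))
    {q : EuclideanSpace ℝ (Fin d)} (hq : q ∈ frontier ΩO) : LscAt W G q := by
  intro c hc
  rw [hGf q hq, EReal.coe_lt_coe_iff] at hc
  have hqO : q ∉ ΩO := by
    intro h1
    exact hq.2 (h.isOpen_outer.interior_eq.symm ▸ h1)
  obtain ⟨l, hl⟩ := geometric_hahn_banach_open_point h.convex_outer h.isOpen_outer hqO
  obtain ⟨u, hu, hlu⟩ := exists_ker_ne_zero hd l
  have hqC : q ∉ closure (convexHull ℝ ΩI) := fun h1 => hqO (h.closure_subset h1)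
  have h1 : ∀ᶠ z in 𝓝 q, z ∈ frontier ΩO → c < f z :=
    eventually_nhdsWithin_iff.1 ((hf q hq).eventually (lt_mem_nhds hc))
  have h2 : ∀ᶠ z in 𝓝 q, z ∉ closure (convexHull ℝ ΩI) :=
    isClosed_closure.isOpen_compl.mem_nhds hqC
  obtain ⟨ε, hε, hball⟩ := Metric.eventually_nhds_iff_ball.1 (h1.and h2)
  have hun : 0 < ‖u‖ := norm_pos_iff.2 hu
  set η := ε / (2 * ‖u‖) with hη
  have hη0 : 0 < η := by positivity
  have hηu : η * ‖u‖ = ε / 2 := by rw [hη]; field_simp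
  have hout : ∀ v ∈ ({u, -u} : Set _), q + η • v ∉ closure ΩO := by
    intro v hv hmem
    have hv0 : v ≠ 0 ∧ l v = 0 := by
      rcases hv with rfl | rfl
      · exact ⟨hu, hlu⟩
      · exact ⟨neg_ne_zero.2 hu, by simp [hlu]⟩
    have hne : q ≠ q + η • v := by
      intro he
      have := left_eq_add.1 he
      exact (smul_ne_zero hη0.ne' hv0.1) this
    have hint := h.strictConvex_outer hq.1 hmem hne (a := 1 / 2) (b := 1 / 2)
      (by norm_num) (by norm_num) (by norm_num)
    rw [h.convex_outer.interior_closure_eq_interior_of_nonempty_interior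
      (by rw [h.isOpen_outer.interior_eq]; exact h.nonempty_outer),
      h.isOpen_outer.interior_eq] at hint
    have := hl _ hint
    simp only [map_add, map_smul, smul_eq_mul, hv0.2] at this
    linarith
  have hev : ∀ v ∈ ({u, -u} : Set _), ∀ᶠ y in 𝓝 q, y + η • v ∉ closure ΩO := by
    intro v hv
    have hc : Continuous fun y : EuclideanSpace ℝ (Fin d) => y + η • v := by fun_prop
    exact (hc.tendsto q).eventually (isClosed_closure.isOpen_compl.mem_nhds (hout v hv))
  filter_upwards [nhdsWithin_le_nhds (hev u (by simp)), nhdsWithin_le_nhds (hev (-u) (by simp)),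
    nhdsWithin_le_nhds (ball_mem_nhds q (half_pos hε)), self_mem_nhdsWithin] with y hy1 hy2 hy3 hyW
  have hyc := hW hyW
  obtain ⟨t, ht, hft, -⟩ := exists_exit hyc hη0.le hy1 h.convex_outer
  obtain ⟨s, hs, hfs, -⟩ := exists_exit hyc hη0.le hy2 h.convex_outer
  have hnear : ∀ t ∈ Ico 0 η, ∀ v : EuclideanSpace ℝ (Fin d), ‖v‖ = ‖u‖ →
      y + t • v ∈ ball q ε := by
    intro t ht v hv
    rw [mem_ball, dist_eq_norm] at hy3 ⊢
    have h3 : ‖t • v‖ < ε / 2 := by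
      rw [norm_smul, hv, Real.norm_of_nonneg ht.1, ← hηu]
      exact mul_lt_mul_of_pos_right ht.2 hun
    calc ‖y + t • v - q‖ = ‖(y - q) + t • v‖ := by congr 1; abel
      _ ≤ ‖y - q‖ + ‖t • v‖ := norm_add_le _ _
      _ < ε := by linarith
  have hta := hnear t ht u rfl
  have hsa := hnear s hs (-u) (norm_neg u)
  refine hG.le_of_mem_segment (q := y + t • u) (z := y + s • (-u)) (fun z hz => hW' ⟨?_, ?_⟩)
    ?_ ?_ (mem_segment_add_smul hs.1 ht.1)
  · exact h.convex_outer.closure.segment_subset hft.1 hfs.1 hz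
  · exact (hball z ((convex_ball q ε).segment_subset hta hsa hz)).2
  · rw [hGf _ hft]
    exact EReal.coe_le_coe_iff.2 ((hball _ hta).1 hft).le
  · rw [hGf _ hfs]
    exact EReal.coe_le_coe_iff.2 ((hball _ hsa).1 hfs).le

theorem lsc_of_good (h : AdmissiblePair ΩO ΩI)
    (hG : LocallyConcaveOn (closure ΩO \ interior (convexHull ℝ ΩI)) G) {m : ℝ}
    (hm : ∀ y ∈ closure ΩO \ interior (convexHull ℝ ΩI), (m : EReal) ≤ G y)
    {q : EuclideanSpace ℝ (Fin d)} (hq : q ∈ ΩO) {l : EuclideanSpace ℝ (Fin d) →L[ℝ] ℝ}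
    (hl : l ≠ 0) (hle : ∀ w ∈ closure (convexHull ℝ ΩI), l w ≤ l q)
    (hgood : q ∉ closure (convexHull ℝ ΩI) ∨
      ∃ ρ > 0, ball q ρ ∩ {y | l y = l q} ⊆ closure (convexHull ℝ ΩI)) :
    LscAt (closure ΩO \ interior (convexHull ℝ ΩI)) G q := by
  intro c hc
  rcases hgood with hgood | ⟨ρ, hρ, hfacet⟩
  · refine nhdsWithin_le_nhds (lsc_of_ball hG hm ?_ c hc)
    filter_upwards [h.isOpen_outer.mem_nhds hq, isClosed_closure.isOpen_compl.mem_nhds hgood]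
      with y hy1 hy2
    exact ⟨subset_closure hy1, fun hi => hy2 (subset_closure (interior_subset hi))⟩
  · have hev := eventually_le_of_facet (convex_convexHull ℝ ΩI) h.nonempty_interior hl hle hρ hfacet
    obtain ⟨r, hr, hb⟩ := h.isOpen_outer_mem_nhds hq
    have h1 := hG.lsc_halfspace hm l hr (fun y hy => ⟨subset_closure (hb hy.1), fun hi =>
      (lt_on_interior_of_le hl (fun w hw => hle w (subset_closure hw)) y hi).not_ge hy.2⟩) hc
    rw [eventually_nhdsWithin_iff] at h1 ⊢
    filter_upwards [hev, h1] with y hy1 hy2 hyW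
    exact hy2 (hy1 hyW.2)

/-- Suppose `y n → x` with `G (y n) < c`. Hyperplanes through `y n` with the hull on one side
converge, along a subsequence, to a supporting hyperplane at `x`. In it choose `u` by
`exists_ker_direction`: at `x ± η • u`, with `η` small, `G` is almost as large as at `x` and is
lower semicontinuous. Tilting `u` into the `n`-th hyperplane gives a segment through `y n` in the
domain whose ends tend to `x ± η • u`; concavity on it forces `G (y n) ≥ c`. -/
theorem lsc_inner_boundary (h : AdmissiblePair ΩO ΩI) (hd : 2 ≤ d)
    (hG : LocallyConcaveOn (closure ΩO \ interior (convexHull ℝ ΩI)) G) {m : ℝ}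
    (hm : ∀ y ∈ closure ΩO \ interior (convexHull ℝ ΩI), (m : EReal) ≤ G y)
    {x : EuclideanSpace ℝ (Fin d)} (hx : x ∈ closure (convexHull ℝ ΩI)) :
    LscAt (closure ΩO \ interior (convexHull ℝ ΩI)) G x := by
  intro c hc
  by_contra hcon
  have hfreq : ∃ᶠ y in 𝓝[closure ΩO \ interior (convexHull ℝ ΩI)] x, ¬ (c : EReal) ≤ G y :=
    Filter.not_eventually.1 hcon
  have hfreq2 := hfreq.and_eventually
    (self_mem_nhdsWithin (s := closure ΩO \ interior (convexHull ℝ ΩI)) (a := x))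
  obtain ⟨y, hylim, hy⟩ := exists_seq_forall_of_frequently hfreq2
  replace hylim : Tendsto y atTop (𝓝 x) := tendsto_nhds_of_tendsto_nhdsWithin hylim
  have hsup : ∀ n, ∃ l : EuclideanSpace ℝ (Fin d) →L[ℝ] ℝ,
      l ∈ sphere (0 : EuclideanSpace ℝ (Fin d) →L[ℝ] ℝ) 1 ∧
      ∀ w ∈ closure (convexHull ℝ ΩI), l w ≤ l (y n) := by
    intro n
    obtain ⟨l, p, hl, -, hle, hpy, -⟩ :=
      exists_supporting_functional (convex_convexHull ℝ ΩI) h.nonempty_interior (hy n).2.2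
    have hln : 0 < ‖l‖ := norm_pos_iff.2 hl
    refine ⟨‖l‖⁻¹ • l, ?_, fun w hw => ?_⟩
    · rw [mem_sphere_zero_iff_norm, norm_smul, norm_inv, norm_norm, inv_mul_cancel₀ hln.ne']
    · simp only [smul_apply, smul_eq_mul]
      exact mul_le_mul_of_nonneg_left ((hle w hw).trans hpy) (inv_nonneg.2 hln.le)
  choose ln hlnS hln using hsup
  have hprop : ProperSpace (EuclideanSpace ℝ (Fin d) →L[ℝ] ℝ) := FiniteDimensional.proper ℝ _
  obtain ⟨l, hlS, φ, hφ, hlim⟩ :=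
    (isCompact_sphere (0 : EuclideanSpace ℝ (Fin d) →L[ℝ] ℝ) 1).tendsto_subseq hlnS
  have hl : l ≠ 0 := ne_of_mem_sphere hlS one_ne_zero
  have hne : ∀ n, ln n ≠ 0 := fun n => ne_of_mem_sphere (hlnS n) one_ne_zero
  have hyφ : Tendsto (y ∘ φ) atTop (𝓝 x) := hylim.comp hφ.tendsto_atTop
  have happ : ∀ {z : ℕ → EuclideanSpace ℝ (Fin d)} {z₀}, Tendsto z atTop (𝓝 z₀) →
      Tendsto (fun n => ln (φ n) (z n)) atTop (𝓝 (l z₀)) := by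
    intro z z₀ hz
    exact (isBoundedBilinearMap_apply.continuous.tendsto (l, z₀)).comp (hlim.prodMk_nhds hz)
  have hle : ∀ w ∈ closure (convexHull ℝ ΩI), l w ≤ l x := fun w hw =>
    le_of_tendsto_of_tendsto' (happ (tendsto_const_nhds (x := w))) (happ hyφ)
      fun n => hln (φ n) w hw
  obtain ⟨u, hu, hlu, η₀, hη₀, hgood⟩ := exists_ker_direction
    (convex_convexHull ℝ ΩI).closure hx l (exists_ker_ne_zero hd l)
  have hxO : x ∈ ΩO := h.closure_subset hx
  obtain ⟨r, hr, hb⟩ := h.isOpen_outer_mem_nhds hxO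
  have hhalf : ∀ {c : ℝ}, (c : EReal) < G x →
      ∀ᶠ y in 𝓝[{y | l x ≤ l y}] x, (c : EReal) ≤ G y := fun hc =>
    hG.lsc_halfspace hm l hr (fun y hy => ⟨subset_closure (hb hy.1), fun hi =>
      (lt_on_interior_of_le hl (fun w hw => hle w (subset_closure hw)) y hi).not_ge hy.2⟩) hc
  obtain ⟨c', hcc', hc'⟩ := EReal.lt_iff_exists_real_btwn.1 hc
  have hline : ∀ v ∈ ({u, -u} : Set _), ∀ᶠ η in 𝓝[>] (0 : ℝ),
      (c' : EReal) ≤ G (x + η • v) ∧ x + η • v ∈ ΩO := by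
    intro v hv
    have hlv : l v = 0 := by
      rcases hv with rfl | rfl
      · exact hlu
      · simp [hlu]
    have hcont : Continuous fun η : ℝ => x + η • v := by fun_prop
    have ht : Tendsto (fun η : ℝ => x + η • v) (𝓝 0) (𝓝 x) := by simpa using hcont.tendsto 0
    have ht2 : Tendsto (fun η : ℝ => x + η • v) (𝓝 0) (𝓝[{y | l x ≤ l y}] x) :=
      tendsto_nhdsWithin_iff.2 ⟨ht, Eventually.of_forall fun η => by simp [hlv]⟩
    exact ((ht2.eventually (hhalf hc')).and
      (ht.eventually (h.isOpen_outer.mem_nhds hxO))).filter_mono nhdsWithin_le_nhds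
  obtain ⟨η, ⟨⟨hηp, hηpO⟩, hηm, hηmO⟩, hηI⟩ :=
    (((hline u (by simp)).and (hline (-u) (by simp))).and (Ioo_mem_nhdsGT hη₀)).exists
  have hlsc : ∀ v ∈ ({u, -u} : Set _), (c' : EReal) ≤ G (x + η • v) → x + η • v ∈ ΩO →
      ∀ᶠ y in 𝓝[closure ΩO \ interior (convexHull ℝ ΩI)] (x + η • v), (c : EReal) ≤ G y := by
    intro v hv hcv hvO
    have hlv : l (x + η • v) = l x := by
      rcases hv with rfl | rfl <;> simp [hlu]
    refine h.lsc_of_good hG hm hvO hl (fun w hw => ?_) (hgood η hηI v hv) c (hcc'.trans_le hcv)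
    rw [hlv]
    exact hle w hw
  obtain ⟨w, hw⟩ : ∃ w, l w = 1 := by
    obtain ⟨w, hw⟩ : ∃ w, l w ≠ 0 := by
      by_contra! h0
      exact hl (ContinuousLinearMap.ext h0)
    exact ⟨(l w)⁻¹ • w, by simp [hw]⟩
  -- The direction `u` corrected along `w` so as to lie in the kernel of `ln (φ n)`; the correction
  -- vanishes in the limit because `l u = 0` and `l w = 1`.
  let un : ℕ → EuclideanSpace ℝ (Fin d) := fun n => u - (ln (φ n) u / ln (φ n) w) • w
  have hwlim := happ (tendsto_const_nhds (x := w))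
  have hunlim : Tendsto un atTop (𝓝 u) := by
    have h1 : Tendsto (fun n => ln (φ n) u / ln (φ n) w) atTop (𝓝 (l u / l w)) :=
      (happ (tendsto_const_nhds (x := u))).div hwlim (by simp [hw])
    have h2 := (tendsto_const_nhds (x := u)).sub (h1.smul_const w)
    simpa [hlu] using h2
  have hunker : ∀ᶠ n in atTop, ln (φ n) (un n) = 0 := by
    have h1 : ∀ᶠ n in atTop, ln (φ n) w ≠ 0 :=
      hwlim.eventually (isOpen_ne.mem_nhds (by simp [hw]))
    filter_upwards [h1] with n hn
    simp only [un, map_sub, map_smul, smul_eq_mul]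
    field_simp
    ring
  have hmemW : ∀ n, ∀ z ∈ ΩO, ln (φ n) z = ln (φ n) (y (φ n)) →
      z ∈ closure ΩO \ interior (convexHull ℝ ΩI) := fun n z hz hlz =>
    ⟨subset_closure hz, fun hi => (lt_on_interior_of_le (hne (φ n))
      (fun w hw => hln (φ n) w (subset_closure hw)) z hi).ne hlz⟩
  have hp : Tendsto (fun n => y (φ n) + η • un n) atTop (𝓝 (x + η • u)) :=
    hyφ.add (hunlim.const_smul η)
  have hn : Tendsto (fun n => y (φ n) + η • (-un n)) atTop (𝓝 (x + η • (-u))) :=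
    hyφ.add (hunlim.neg.const_smul η)
  have e1 := hp.eventually (eventually_nhdsWithin_iff.1 (hlsc u (by simp) hηp hηpO))
  have e2 := hn.eventually (eventually_nhdsWithin_iff.1 (hlsc (-u) (by simp) hηm hηmO))
  have e3 := hp.eventually (h.isOpen_outer.mem_nhds hηpO)
  have e4 := hn.eventually (h.isOpen_outer.mem_nhds hηmO)
  obtain ⟨n, h1, h2, h3, h4, h5⟩ := (e1.and (e2.and (e3.and (e4.and hunker)))).exists
  refine (hy (φ n)).1 ?_
  have hlp : ln (φ n) (y (φ n) + η • un n) = ln (φ n) (y (φ n)) := by simp [h5]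
  have hlm : ln (φ n) (y (φ n) + η • (-un n)) = ln (φ n) (y (φ n)) := by simp [h5]
  refine hG.le_of_mem_segment (fun z hz => ?_) (h1 (hmemW n _ h3 hlp)) (h2 (hmemW n _ h4 hlm))
    (mem_segment_add_smul hηI.1.le hηI.1.le)
  refine hmemW n z (h.convex_outer.segment_subset h3 h4 hz) ?_
  obtain ⟨a, b, -, -, hab, rfl⟩ := hz
  rw [map_add, map_smul, map_smul, hlp, hlm, smul_eq_mul, smul_eq_mul, ← add_mul, hab, one_mul]

theorem lsc (h : AdmissiblePair ΩO ΩI) (hd : 2 ≤ d)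
    (hG : LocallyConcaveOn (closure ΩO \ interior (convexHull ℝ ΩI)) G) {m : ℝ}
    (hm : ∀ y ∈ closure ΩO \ interior (convexHull ℝ ΩI), (m : EReal) ≤ G y)
    {f : EuclideanSpace ℝ (Fin d) → ℝ} (hf : ContinuousOn f (frontier ΩO))
    (hGf : ∀ z ∈ frontier ΩO, G z = (f z : EReal))
    {q : EuclideanSpace ℝ (Fin d)} (hq : q ∈ closure ΩO) :
    LscAt (closure ΩO \ interior (convexHull ℝ ΩI)) G q := by
  by_cases hqO : q ∈ ΩO
  · by_cases hqC : q ∈ closure (convexHull ℝ ΩI)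
    · exact h.lsc_inner_boundary hd hG hm hqC
    · intro c hc
      refine nhdsWithin_le_nhds (lsc_of_ball hG hm ?_ c hc)
      filter_upwards [h.isOpen_outer.mem_nhds hqO, isClosed_closure.isOpen_compl.mem_nhds hqC]
        with y hy1 hy2
      exact ⟨subset_closure hy1, fun hi => hy2 (subset_closure (interior_subset hi))⟩
  · refine h.lsc_frontier hd sdiff_subset (fun z hz => ⟨hz.1, fun hi => hz.2 (subset_closure
      (interior_subset hi))⟩) hG hf hGf ⟨hq, ?_⟩
    rwa [h.isOpen_outer.interior_eq]

end AdmissiblePair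

end

/-! ### Flat pieces of the hull's boundary, and closedness of the hull -/

section
theorem coe_le_of_forall_lt {μ : ℝ} {X : EReal} (h : ∀ ν : ℝ, ν < μ → (ν : EReal) ≤ X) :
    (μ : EReal) ≤ X := by
  by_contra! hlt
  obtain ⟨ν, h1, h2⟩ := EReal.lt_iff_exists_real_btwn.1 hlt
  exact h1.not_ge (h ν (EReal.coe_lt_coe_iff.1 h2))

theorem coe_le_liminf_iff {α : Type*} {F : Filter α} {u : α → EReal} {μ : ℝ} :
    (μ : EReal) ≤ liminf u F ↔ ∀ ν : ℝ, ν < μ → ∀ᶠ a in F, (ν : EReal) ≤ u a := by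
  rw [le_liminf_iff]
  constructor
  · intro h ν hν
    exact (h ν (EReal.coe_lt_coe_iff.2 hν)).mono fun a ha => ha.le
  · intro h y hy
    obtain ⟨ν, h1, h2⟩ := EReal.lt_iff_exists_real_btwn.1 hy
    exact (h ν (EReal.coe_lt_coe_iff.1 h2)).mono fun a ha => h1.trans_le ha

/-- A preconnected set that misses the frontier of `ω` and meets `ω` lies in `ω`. -/
theorem IsPreconnected.subset_of_disjoint_frontier {X : Type*} [TopologicalSpace X] {s ω : Set X}
    (hs : IsPreconnected s) (hd : Disjoint s (frontier ω)) (hne : (s ∩ ω).Nonempty) : s ⊆ ω := by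
  have hint : ∀ x ∈ s, x ∈ ω → x ∈ interior ω := fun x hx hω => by
    by_contra hni
    exact disjoint_left.1 hd hx ⟨subset_closure hω, hni⟩
  have hcl : ∀ x ∈ s, x ∈ closure ω → x ∈ interior ω := fun x hx hω => by
    by_contra hni
    exact disjoint_left.1 hd hx ⟨hω, hni⟩
  obtain ⟨x, hx, hxω⟩ := hne
  have := hs.subset_left_of_subset_union isOpen_interior isClosed_closure.isOpen_compl
    (disjoint_left.2 fun y hy hy' => hy' (subset_closure (interior_subset hy)))
    (fun y hy => by
      by_cases hyc : y ∈ closure ω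
      · exact Or.inl (hcl y hy hyc)
      · exact Or.inr hyc) ⟨x, hx, hint x hx hxω⟩
  exact this.trans interior_subset

variable {d : ℕ} {ΩO ΩI : Set (EuclideanSpace ℝ (Fin d))}
  {G : EuclideanSpace ℝ (Fin d) → EReal}

namespace AdmissiblePair

/-- Near a boundary point of the hull outside the inner set, the hull is a half-space. -/
theorem exists_facet (h : AdmissiblePair ΩO ΩI) {z : EuclideanSpace ℝ (Fin d)}
    (hz : z ∈ frontier (convexHull ℝ ΩI)) (hzI : z ∉ ΩI) :
    ∃ r > 0, ∃ (l : EuclideanSpace ℝ (Fin d) →L[ℝ] ℝ) (ω : Set (EuclideanSpace ℝ (Fin d))),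
      l ≠ 0 ∧ (∀ w ∈ closure (convexHull ℝ ΩI), l w ≤ l z) ∧
      (∃ y ∈ convexHull ℝ ΩI, l y = l z) ∧ (∀ y ∈ frontier ω, y ∉ ΩI → l y = l z) ∧
      ω ⊆ interior (convexHull ℝ ΩI) ∧ ball z r ∩ interior (convexHull ℝ ΩI) ⊆ ω ∧
      ball z r ∩ {y | l y < l z} ⊆ interior (convexHull ℝ ΩI) := by
  have hC := convex_convexHull ℝ ΩI
  have hclos := hC.closure_interior_eq_closure_of_nonempty_interior h.nonempty_interior
  obtain ⟨r, hr, hball⟩ := Metric.isOpen_iff.1 h.isClosed_inner.isOpen_compl z hzI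
  have hmeet : ∀ y ∈ ball z r, y ∈ closure (convexHull ℝ ΩI) →
      y ∈ closure (ball z r ∩ interior (convexHull ℝ ΩI)) := by
    intro y hy hyc
    rw [← hclos] at hyc
    exact isOpen_ball.inter_closure ⟨hy, hyc⟩
  obtain ⟨y₀, hy₀⟩ : (ball z r ∩ interior (convexHull ℝ ΩI)).Nonempty :=
    closure_nonempty_iff.1 ⟨z, hmeet z (mem_ball_self hr) hz.1⟩
  let ω := connectedComponentIn (interior (convexHull ℝ ΩI) \ ΩI) y₀
  have hωsub : ω ⊆ interior (convexHull ℝ ΩI) :=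
    (connectedComponentIn_subset _ _).trans sdiff_subset
  have hsubω : ball z r ∩ interior (convexHull ℝ ΩI) ⊆ ω :=
    ((convex_ball z r).inter hC.interior).isPreconnected.subset_connectedComponentIn hy₀
      fun y hy => ⟨hy.2, hball hy.1⟩
  obtain ⟨l, c, ⟨hl, hle, hex⟩, hfr⟩ := h.supporting ω ⟨y₀, ⟨hy₀.2, hball hy₀.1⟩, rfl⟩
  -- Inside the ball, `ω` fills the interior of the hull, so frontier points of the hull are
  -- frontier points of `ω` off `ΩI`.
  have hflat : ∀ y ∈ ball z r, y ∈ frontier (convexHull ℝ ΩI) → l y = c := by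
    intro y hy hyf
    refine hfr y ⟨⟨closure_mono hsubω (hmeet y hy hyf.1), fun hi => ?_⟩, hball hy⟩
    exact hyf.2 (hωsub (interior_subset hi))
  have hlz := hflat z (mem_ball_self hr) hz
  subst hlz
  refine ⟨r, hr, l, ω, hl, ?_, hex, fun y hy hyI => hfr y ⟨hy, hyI⟩, hωsub, hsubω, ?_⟩
  · exact fun w hw => closure_minimal (t := {w | l w ≤ l z}) hle
      (isClosed_le l.continuous continuous_const) hw
  -- The half-ball is connected, misses the frontier of the hull and contains the interior point
  -- `y₀`.
  · refine interior_maximal (IsPreconnected.subset_of_disjoint_frontier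
      ((convex_ball z r).inter (convex_halfSpace_lt l.isLinear _)).isPreconnected ?_
      ⟨y₀, ⟨hy₀.1, lt_on_interior_of_le hl hle y₀ hy₀.2⟩, interior_subset hy₀.2⟩)
      (isOpen_ball.inter (isOpen_lt l.continuous continuous_const))
    exact disjoint_left.2 fun y hy hyf => hy.2.ne (hflat y hy.1 hyf)

/-- A missing limit point `x` would lie off `ΩI` on a flat piece of the boundary. Along a line in
its hyperplane the closed hull ends on both sides, since the boundary has no rays, and each end is
in `ΩI`: otherwise the hull would be a half-space near that end and would continue. So `x` lies
between two points of `ΩI`. -/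
theorem isClosed_hull (h : AdmissiblePair ΩO ΩI) (hd : 2 ≤ d) : IsClosed (convexHull ℝ ΩI) := by
  rw [← closure_subset_iff_isClosed]
  intro x hx
  by_contra hxC
  have hxI : x ∉ ΩI := fun hxI => hxC (subset_convexHull ℝ ΩI hxI)
  have hxf : x ∈ frontier (convexHull ℝ ΩI) := ⟨hx, fun hi => hxC (interior_subset hi)⟩
  obtain ⟨r, hr, l, ω, hl, hle, -, -, -, -, hhalf⟩ := h.exists_facet hxf hxI
  obtain ⟨u, hu, hlu⟩ := exists_ker_ne_zero hd l
  -- each ray from `x` inside the facet leaves it at a point of `ΩI`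
  have key : ∀ v, v ≠ 0 → l v = 0 → ∃ t : ℝ, 0 ≤ t ∧ x + t • v ∈ ΩI := by
    intro v hv hlv
    have hray : ∃ t : ℝ, 0 ≤ t ∧ x + t • v ∉ closure (convexHull ℝ ΩI) := by
      by_contra! hcon
      exact h.no_rays x v hv fun t ht =>
        h.mem_frontier_of_eq hl hle (hcon t ht) (by simp [hlv])
    obtain ⟨η, hη, hout⟩ := hray
    let T := {t : ℝ | t ∈ Icc 0 η ∧ x + t • v ∈ closure (convexHull ℝ ΩI)}
    have hcont : Continuous fun t : ℝ => x + t • v := by fun_prop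
    have hT : IsCompact T := isCompact_Icc.inter_right (isClosed_closure.preimage hcont)
    obtain ⟨t, ⟨ht, htC⟩, hmax⟩ := hT.exists_isGreatest ⟨0, ⟨le_rfl, hη⟩, by simpa using hx⟩
    have htη : t < η := lt_of_le_of_ne ht.2 (by rintro rfl; exact hout htC)
    refine ⟨t, ht.1, ?_⟩
    by_contra htI
    have htf := h.mem_frontier_of_eq hl hle htC (by simp [hlv])
    obtain ⟨r', hr', l', -, hl', hle', -, -, -, -, hhalf'⟩ := h.exists_facet htf htI
    have hlt : l (x + t • v) = l x := by simp [hlv]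
    set e := x + t • v with he
    -- The half-ball below `l'` at `e` lies in the hull, where `l ≤ l e`. This inclusion of
    -- half-spaces forces `l' v = 0`.
    have hcl : ∀ w, l' w < 0 → l w ≤ 0 := by
      intro w hw
      have hlim : Tendsto (fun s : ℝ => e + s • w) (𝓝[>] 0) (𝓝 e) := by
        have hc : Continuous (fun s : ℝ => e + s • w) := by fun_prop
        have h2 := hc.tendsto 0
        simp only [zero_smul, add_zero] at h2
        exact h2.mono_left nhdsWithin_le_nhds
      obtain ⟨s, hs, hs0⟩ := ((hlim.eventually (ball_mem_nhds e hr')).and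
        self_mem_nhdsWithin).exists
      have hs0' : 0 < s := hs0
      have h3 := hhalf' ⟨hs, by
        simp only [mem_ofPred_eq, map_add, map_smul, smul_eq_mul]
        nlinarith⟩
      have h4 := hle _ (subset_closure (interior_subset h3))
      rw [map_add, hlt, map_smul, smul_eq_mul] at h4
      by_contra! hlw
      nlinarith
    have hl'v : l' v = 0 := by
      by_contra hne
      obtain ⟨w, hw⟩ : ∃ w, 0 < l w := by
        by_contra! h0
        refine hl (ContinuousLinearMap.ext fun w => le_antisymm (h0 w) ?_)
        have := h0 (-w)
        simp only [map_neg] at this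
        simpa using this
      have h5 : l' (w + (-(l' w + 1) / l' v) • v) < 0 := by
        simp only [map_add, map_smul, smul_eq_mul]
        rw [div_mul_cancel₀ _ hne]
        linarith
      have h6 := hcl _ h5
      simp only [map_add, map_smul, smul_eq_mul, hlv] at h6
      linarith
    have hlim : Tendsto (fun s : ℝ => e + s • v) (𝓝[>] 0) (𝓝 e) := by
      have hc : Continuous (fun s : ℝ => e + s • v) := by fun_prop
      have h2 := hc.tendsto 0
      simp only [zero_smul, add_zero] at h2
      exact h2.mono_left nhdsWithin_le_nhds
    -- As `l' v = 0`, points slightly beyond `e` along `v` are limits of the half-ball, hence in the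
    -- closed hull, against the maximality of `t`.
    obtain ⟨s, hs, hs0, hsη⟩ := ((hlim.eventually (ball_mem_nhds e hr')).and
      (Ioo_mem_nhdsGT (sub_pos.2 htη))).exists
    have hmem : e + s • v ∈ closure (convexHull ℝ ΩI) := by
      have h7 : e + s • v ∈ closure (ball e r' ∩ {y | l' y < l' e}) := by
        refine isOpen_ball.inter_closure ⟨hs, ?_⟩
        obtain ⟨w, hw⟩ : ∃ w, l' w < 0 := by
          by_contra! h0
          refine hl' (ContinuousLinearMap.ext fun w => le_antisymm ?_ (h0 w))
          have := h0 (-w)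
          simp only [map_neg] at this
          simpa using this
        have hlim2 : Tendsto (fun a : ℝ => (e + s • v) + a • w) (𝓝[>] 0) (𝓝 (e + s • v)) := by
          have hc : Continuous (fun a : ℝ => (e + s • v) + a • w) := by fun_prop
          have h2 := hc.tendsto 0
          simp only [zero_smul, add_zero] at h2
          exact h2.mono_left nhdsWithin_le_nhds
        refine mem_closure_of_tendsto hlim2 ?_
        filter_upwards [self_mem_nhdsWithin] with a ha
        have ha' : 0 < a := ha
        simp only [map_add, map_smul, smul_eq_mul, hl'v]
        nlinarith
      exact closure_mono (hhalf'.trans interior_subset) h7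
    have : t + s ≤ t := hmax ⟨⟨by linarith [ht.1], by linarith⟩, by
      rw [add_smul, ← add_assoc]; exact hmem⟩
    linarith
  obtain ⟨t, ht, htI⟩ := key u hu hlu
  obtain ⟨s, hs, hsI⟩ := key (-u) (neg_ne_zero.2 hu) (by simp [hlu])
  exact hxC ((convex_convexHull ℝ ΩI).segment_subset (subset_convexHull ℝ ΩI htI)
    (subset_convexHull ℝ ΩI hsI) (mem_segment_add_smul hs ht))

end AdmissiblePair

end

/-! ### Radial extension to the boundary of the hull -/

section
variable {d : ℕ} {ΩO ΩI : Set (EuclideanSpace ℝ (Fin d))}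
  {G : EuclideanSpace ℝ (Fin d) → EReal}

/-- Extension of a function to the inner boundary by radial lower limits from outside, with the
centre of dilation `p`; boundary values on `∂ΩO` are kept. -/
noncomputable def radialExtension (ΩO : Set (EuclideanSpace ℝ (Fin d)))
    (p : EuclideanSpace ℝ (Fin d)) (G : EuclideanSpace ℝ (Fin d) → EReal)
    (y : EuclideanSpace ℝ (Fin d)) : EReal :=
  open Classical in
  if y ∈ ΩO then liminf (fun ε : ℝ => G (y + ε • (y - p))) (𝓝[>] 0) else G y

theorem coe_le_radialExtension_iff {p y : EuclideanSpace ℝ (Fin d)} (hy : y ∈ ΩO) {μ : ℝ} :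
    (μ : EReal) ≤ radialExtension ΩO p G y ↔
      ∀ ν : ℝ, ν < μ → ∀ᶠ ε in 𝓝[>] (0 : ℝ), (ν : EReal) ≤ G (y + ε • (y - p)) := by
  rw [radialExtension, if_pos hy, coe_le_liminf_iff]

theorem tendsto_dilation (p y : EuclideanSpace ℝ (Fin d)) :
    Tendsto (fun ε : ℝ => y + ε • (y - p)) (𝓝[>] 0) (𝓝 y) := by
  have hc : Continuous (fun ε : ℝ => y + ε • (y - p)) := by fun_prop
  have h2 := hc.tendsto 0
  simp only [zero_smul, add_zero] at h2
  exact h2.mono_left nhdsWithin_le_nhds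

theorem dilation_notMem {C : Set (EuclideanSpace ℝ (Fin d))} (hC : Convex ℝ C)
    {p y : EuclideanSpace ℝ (Fin d)} (hp : p ∈ interior C) (hy : y ∉ interior C) {ε : ℝ}
    (hε : 0 < ε) : y + ε • (y - p) ∉ C := by
  intro hmem
  have := hC.combo_self_interior_mem_interior hmem hp (a := 1 / (1 + ε)) (b := ε / (1 + ε))
    (by positivity) (by positivity) (by field_simp)
  have h1 : (1 / (1 + ε)) • (y + ε • (y - p)) + (ε / (1 + ε)) • p = y := by
    rw [smul_add, smul_smul, smul_sub, one_div_mul_eq_div]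
    have h2 : 1 / (1 + ε) + ε / (1 + ε) = 1 := by field_simp
    calc _ = (1 / (1 + ε) + ε / (1 + ε)) • y := by module
      _ = y := by rw [h2, one_smul]
  rw [h1] at this
  exact hy this

namespace AdmissiblePair

/-- Dilation about the interior point `p` carries a segment that misses the interior of the hull to
one that misses the hull itself, where `G` is concave; the inequality then passes to the lower
limit. -/
theorem radialExtension_combo (h : AdmissiblePair ΩO ΩI)
    (hG : LocallyConcaveOn (closure ΩO \ convexHull ℝ ΩI) G)
    {p : EuclideanSpace ℝ (Fin d)} (hp : p ∈ interior (convexHull ℝ ΩI))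
    {y₁ y₂ : EuclideanSpace ℝ (Fin d)} (h₁ : y₁ ∈ ΩO) (h₂ : y₂ ∈ ΩO)
    (hseg : Disjoint (segment ℝ y₁ y₂) (interior (convexHull ℝ ΩI))) {μ₁ μ₂ a b : ℝ}
    (hμ₁ : (μ₁ : EReal) ≤ radialExtension ΩO p G y₁)
    (hμ₂ : (μ₂ : EReal) ≤ radialExtension ΩO p G y₂)
    (ha : 0 ≤ a) (hb : 0 ≤ b) (hab : a + b = 1) :
    ((a * μ₁ + b * μ₂ : ℝ) : EReal) ≤ radialExtension ΩO p G (a • y₁ + b • y₂) := by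
  rw [coe_le_radialExtension_iff h₁] at hμ₁
  rw [coe_le_radialExtension_iff h₂] at hμ₂
  rw [coe_le_radialExtension_iff (h.convex_outer h₁ h₂ ha hb hab)]
  intro ν hν
  set δ := a * μ₁ + b * μ₂ - ν with hδ
  have hδ0 : 0 < δ := sub_pos.2 hν
  filter_upwards [hμ₁ (μ₁ - δ) (by linarith), hμ₂ (μ₂ - δ) (by linarith),
    (tendsto_dilation p y₁).eventually (h.isOpen_outer.mem_nhds h₁),
    (tendsto_dilation p y₂).eventually (h.isOpen_outer.mem_nhds h₂), self_mem_nhdsWithin]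
    with ε e1 e2 e3 e4 e5
  have hdil : ∀ a b : ℝ, a + b = 1 →
      a • (y₁ + ε • (y₁ - p)) + b • (y₂ + ε • (y₂ - p)) =
        (a • y₁ + b • y₂) + ε • ((a • y₁ + b • y₂) - p) := by
    intro a b hab
    have : p = (a + b) • p := by rw [hab, one_smul]
    calc _ = (a • y₁ + b • y₂) + ε • ((a • y₁ + b • y₂) - (a + b) • p) := by module
      _ = _ := by rw [← this]
  have := hG.combo_le (q := y₁ + ε • (y₁ - p)) (z := y₂ + ε • (y₂ - p)) (fun z hz => ?_)
    e1 e2 ha hb hab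
  · rw [hdil a b hab] at this
    convert this using 2
    linear_combination hδ + δ * hab
  · refine ⟨subset_closure (h.convex_outer.segment_subset e3 e4 hz), ?_⟩
    obtain ⟨a', b', ha', hb', hab', rfl⟩ := hz
    rw [hdil a' b' hab']
    exact dilation_notMem (convex_convexHull ℝ ΩI) hp
      (disjoint_left.1 hseg ⟨a', b', ha', hb', hab', rfl⟩) e5

theorem le_radialExtension (h : AdmissiblePair ΩO ΩI) (hC : IsClosed (convexHull ℝ ΩI))
    (hG : LocallyConcaveOn (closure ΩO \ convexHull ℝ ΩI) G) {m : ℝ}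
    (hm : ∀ y ∈ closure ΩO \ convexHull ℝ ΩI, (m : EReal) ≤ G y)
    (p : EuclideanSpace ℝ (Fin d)) {y : EuclideanSpace ℝ (Fin d)} (hy : y ∈ ΩO)
    (hyC : y ∉ convexHull ℝ ΩI) : G y ≤ radialExtension ΩO p G y := by
  refine EReal.ge_of_forall_gt_iff_ge.1 fun c hc => ?_
  rw [coe_le_radialExtension_iff hy]
  intro ν hν
  refine (tendsto_dilation p y).eventually (lsc_of_ball hG hm ?_ ν ?_)
  · filter_upwards [h.isOpen_outer.mem_nhds hy, hC.isOpen_compl.mem_nhds hyC] with z h1 h2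
    exact ⟨subset_closure h1, h2⟩
  · exact (EReal.coe_lt_coe_iff.2 hν).trans hc

/-- The point `y` lies between its dilate, where `G` is nearly the lower limit along small `ε`, and
a fixed point towards `p`, where `G ≥ m`. The weight of the latter vanishes as `ε → 0`. -/
theorem radialExtension_le (h : AdmissiblePair ΩO ΩI) (hC : IsClosed (convexHull ℝ ΩI))
    (hG : LocallyConcaveOn (closure ΩO \ convexHull ℝ ΩI) G) {m : ℝ}
    (hm : ∀ y ∈ closure ΩO \ convexHull ℝ ΩI, (m : EReal) ≤ G y)
    (p : EuclideanSpace ℝ (Fin d)) {y : EuclideanSpace ℝ (Fin d)}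
    (hyC : y ∉ convexHull ℝ ΩI) : radialExtension ΩO p G y ≤ G y := by
  by_cases hy : y ∈ ΩO
  swap
  · rw [radialExtension, if_neg hy]
  refine EReal.ge_of_forall_gt_iff_ge.1 fun c hc => ?_
  have hc' := (coe_le_radialExtension_iff hy).1 hc.le
  refine coe_le_of_forall_lt fun ν hν => ?_
  have hnhds : closure ΩO \ convexHull ℝ ΩI ∈ 𝓝 y := by
    filter_upwards [h.isOpen_outer.mem_nhds hy, hC.isOpen_compl.mem_nhds hyC] with z h1 h2
    exact ⟨subset_closure h1, h2⟩
  obtain ⟨r, hr, hball⟩ := Metric.mem_nhds_iff.1 hnhds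
  have hback : Tendsto (fun κ : ℝ => y + κ • (p - y)) (𝓝[>] 0) (𝓝 y) := by
    have hc : Continuous (fun κ : ℝ => y + κ • (p - y)) := by fun_prop
    have h2 := hc.tendsto 0
    simp only [zero_smul, add_zero] at h2
    exact h2.mono_left nhdsWithin_le_nhds
  obtain ⟨κ, hκ, hκ0⟩ := ((hback.eventually (ball_mem_nhds y hr)).and self_mem_nhdsWithin).exists
  replace hκ0 : 0 < κ := hκ0
  set ν' := (ν + c) / 2 with hν'
  have hval : ∀ᶠ ε in 𝓝[>] (0 : ℝ), ν < κ / (ε + κ) * ν' + ε / (ε + κ) * m := by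
    have h1 : ContinuousAt (fun ε : ℝ => κ / (ε + κ) * ν' + ε / (ε + κ) * m) 0 := by
      have : (0 : ℝ) + κ ≠ 0 := by linarith
      fun_prop (disch := exact this)
    have h2 : ∀ᶠ ε in 𝓝 (0 : ℝ), ν < κ / (ε + κ) * ν' + ε / (ε + κ) * m := by
      refine h1.eventually (lt_mem_nhds ?_)
      simp only [zero_add, div_self hκ0.ne', zero_div]
      linarith
    exact h2.filter_mono nhdsWithin_le_nhds
  obtain ⟨ε, e1, e2, e3, e4⟩ := ((hc' ν' (by linarith)).and (hval.and
    (((tendsto_dilation p y).eventually (ball_mem_nhds y hr)).and self_mem_nhdsWithin))).exists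
  replace e4 : 0 < ε := e4
  have hconc := hG.combo_le (((convex_ball y r).segment_subset e3 hκ).trans hball) e1
    (hm _ (hball hκ)) (a := κ / (ε + κ)) (b := ε / (ε + κ)) (by positivity) (by positivity)
    (by field_simp; ring)
  have hy' : (κ / (ε + κ)) • (y + ε • (y - p)) + (ε / (ε + κ)) • (y + κ • (p - y)) = y := by
    rw [smul_add, smul_add, smul_smul, smul_smul]
    have h1 : ε / (ε + κ) * κ = κ / (ε + κ) * ε := by ring
    have h2 : κ / (ε + κ) + ε / (ε + κ) = 1 := by field_simp; ring
    rw [h1]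
    calc _ = (κ / (ε + κ) + ε / (ε + κ)) • y := by module
      _ = y := by rw [h2, one_smul]
  rw [hy'] at hconc
  exact (EReal.coe_le_coe_iff.2 e2.le).trans hconc

/-- Allows an end `y₁ ∈ ∂ΩO`, where the extension is `G` and not a lower limit, to be moved slightly
into `ΩO` at small cost. -/
theorem radialExtension_near (h : AdmissiblePair ΩO ΩI) (hC : IsClosed (convexHull ℝ ΩI))
    (hG : LocallyConcaveOn (closure ΩO \ convexHull ℝ ΩI) G) {m : ℝ}
    (hm : ∀ y ∈ closure ΩO \ convexHull ℝ ΩI, (m : EReal) ≤ G y)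
    {p : EuclideanSpace ℝ (Fin d)} (hp : p ∈ interior (convexHull ℝ ΩI))
    {y₁ y : EuclideanSpace ℝ (Fin d)} (h₁ : y₁ ∈ closure ΩO) (hy : y ∈ ΩO)
    (hseg : Disjoint (segment ℝ y₁ y) (interior (convexHull ℝ ΩI))) {μ ν : ℝ}
    (hμ : (μ : EReal) ≤ radialExtension ΩO p G y₁) (hν : ν < μ) :
    ∀ᶠ η in 𝓝[>] (0 : ℝ), (ν : EReal) ≤ radialExtension ΩO p G ((1 - η) • y₁ + η • y) := by
  have hyint : y ∉ interior (convexHull ℝ ΩI) := disjoint_left.1 hseg (right_mem_segment ℝ _ _)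
  have hcomb : ∀ κ > (0 : ℝ), ∀ᶠ η in 𝓝[>] (0 : ℝ), ν < (1 - η / κ) * μ + (η / κ) * m := by
    intro κ hκ
    have h1 : Continuous (fun η : ℝ => (1 - η / κ) * μ + (η / κ) * m) := by fun_prop
    have h2 : ∀ᶠ η in 𝓝 (0 : ℝ), ν < (1 - η / κ) * μ + (η / κ) * m :=
      (h1.tendsto 0).eventually (lt_mem_nhds (by simpa using hν))
    exact h2.filter_mono nhdsWithin_le_nhds
  by_cases h₁O : y₁ ∈ ΩO
  · have hmy : (m : EReal) ≤ radialExtension ΩO p G y := by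
      rw [coe_le_radialExtension_iff hy]
      intro c hc
      filter_upwards [(tendsto_dilation p y).eventually (h.isOpen_outer.mem_nhds hy),
        self_mem_nhdsWithin] with ε e1 e2
      exact (EReal.coe_le_coe_iff.2 hc.le).trans (hm _ ⟨subset_closure e1,
        dilation_notMem (convex_convexHull ℝ ΩI) hp hyint e2⟩)
    filter_upwards [hcomb 1 one_pos, Ioo_mem_nhdsGT one_pos] with η e1 e2
    rw [div_one] at e1
    exact (EReal.coe_le_coe_iff.2 e1.le).trans (h.radialExtension_combo hG hp h₁O hy hseg hμ hmy
      (by linarith [e2.2]) e2.1.le (by ring))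
  · have h₁C : y₁ ∉ convexHull ℝ ΩI := fun hc => h₁O (h.closure_subset (subset_closure hc))
    rw [radialExtension, if_neg h₁O] at hμ
    have hlim : Tendsto (fun η : ℝ => (1 - η) • y₁ + η • y) (𝓝[>] 0) (𝓝 y₁) := by
      have hc : Continuous (fun η : ℝ => (1 - η) • y₁ + η • y) := by fun_prop
      have h2 := hc.tendsto 0
      simp only [sub_zero, one_smul, zero_smul, add_zero] at h2
      exact h2.mono_left nhdsWithin_le_nhds
    obtain ⟨r, hr, hball⟩ := Metric.isOpen_iff.1 hC.isOpen_compl y₁ h₁C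
    have hconv := h.convex_outer.closure.inter (convex_ball y₁ r)
    obtain ⟨κ, hκ, hκ0, hκ1⟩ := ((hlim.eventually (ball_mem_nhds y₁ hr)).and
      (Ioo_mem_nhdsGT one_pos)).exists
    have hin : ∀ η ∈ Ioo (0 : ℝ) 1, (1 - η) • y₁ + η • y ∈ ΩO := by
      intro η hη
      have := h.convex_outer.combo_closure_interior_mem_interior h₁
        (h.isOpen_outer.interior_eq.symm ▸ hy) (a := 1 - η) (b := η) (by linarith [hη.2]) hη.1
        (by ring)
      rwa [h.isOpen_outer.interior_eq] at this
    have hsub : closure ΩO ∩ ball y₁ r ⊆ closure ΩO \ convexHull ℝ ΩI :=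
      fun z hz => ⟨hz.1, hball hz.2⟩
    have hz : (1 - κ) • y₁ + κ • y ∈ closure ΩO ∩ ball y₁ r :=
      ⟨subset_closure (hin κ ⟨hκ0, hκ1⟩), hκ⟩
    have hsegW := (hconv.segment_subset ⟨h₁, mem_ball_self hr⟩ hz).trans hsub
    filter_upwards [hcomb κ hκ0, Ioo_mem_nhdsGT hκ0] with η e1 e2
    have hη : (1 - η / κ) • y₁ + (η / κ) • ((1 - κ) • y₁ + κ • y) = (1 - η) • y₁ + η • y := by
      rw [smul_add, smul_smul, smul_smul, div_mul_cancel₀ _ hκ0.ne', ← add_assoc, ← add_smul]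
      congr 2
      field_simp
      ring
    have hle1 : η / κ ≤ 1 := (div_le_one hκ0).2 e2.2.le
    have hle0 : 0 ≤ η / κ := div_nonneg e2.1.le hκ0.le
    have hconc := hG.combo_le hsegW hμ (hm _ (hsub hz)) (sub_nonneg.2 hle1) hle0 (by ring)
    have hmem : (1 - η / κ) • y₁ + (η / κ) • ((1 - κ) • y₁ + κ • y) ∈
        closure ΩO \ convexHull ℝ ΩI :=
      hsegW ⟨_, _, sub_nonneg.2 hle1, hle0, by ring, rfl⟩
    rw [hη] at hconc hmem
    exact ((EReal.coe_le_coe_iff.2 e1.le).trans hconc).trans (h.le_radialExtension hC hG hm p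
      (hin η ⟨e2.1, e2.2.trans hκ1⟩) hmem.2)

/-- If the combination `y` is in `ΩO`, both ends are contracted towards `y`, which puts them in `ΩO`
and keeps the combination equal to `y`. If `y ∈ ∂ΩO`, strict convexity makes the ends coincide. -/
theorem radialExtension_locallyConcaveOn (h : AdmissiblePair ΩO ΩI)
    (hC : IsClosed (convexHull ℝ ΩI))
    (hG : LocallyConcaveOn (closure ΩO \ convexHull ℝ ΩI) G) {m : ℝ}
    (hm : ∀ y ∈ closure ΩO \ convexHull ℝ ΩI, (m : EReal) ≤ G y)
    {p : EuclideanSpace ℝ (Fin d)} (hp : p ∈ interior (convexHull ℝ ΩI)) :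
    LocallyConcaveOn (closure ΩO \ interior (convexHull ℝ ΩI)) (radialExtension ΩO p G) := by
  rintro D hD hDc ⟨y₁, μ₁⟩ ⟨h₁, hμ₁⟩ ⟨y₂, μ₂⟩ ⟨h₂, hμ₂⟩ a b ha hb hab
  refine ⟨hDc h₁ h₂ ha hb hab, ?_⟩
  simp only at h₁ h₂ hμ₁ hμ₂
  change ((a * μ₁ + b * μ₂ : ℝ) : EReal) ≤ radialExtension ΩO p G (a • y₁ + b • y₂)
  rcases ha.eq_or_lt with rfl | ha'
  · have : b = 1 := by linarith
    subst this
    simpa using hμ₂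
  rcases hb.eq_or_lt with rfl | hb'
  · have : a = 1 := by linarith
    subst this
    simpa using hμ₁
  by_cases hyO : a • y₁ + b • y₂ ∈ ΩO
  · set y := a • y₁ + b • y₂ with hy
    have hyD : y ∈ D := hDc h₁ h₂ ha hb hab
    have hdisj : ∀ {s}, s ⊆ D → Disjoint s (interior (convexHull ℝ ΩI)) := fun hs =>
      disjoint_left.2 fun z hz => (hD (hs hz)).2
    refine coe_le_of_forall_lt fun ν hν => ?_
    set δ := a * μ₁ + b * μ₂ - ν with hδ
    have hδ0 : 0 < δ := sub_pos.2 hν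
    obtain ⟨η, e1, e2, e3⟩ := ((h.radialExtension_near hC hG hm hp (hD h₁).1 hyO
      (hdisj (hDc.segment_subset h₁ hyD)) hμ₁ (sub_lt_self μ₁ hδ0)).and
      ((h.radialExtension_near hC hG hm hp (hD h₂).1 hyO
      (hdisj (hDc.segment_subset h₂ hyD)) hμ₂ (sub_lt_self μ₂ hδ0)).and
      (Ioo_mem_nhdsGT one_pos))).exists
    have hin : ∀ w ∈ D, (1 - η) • w + η • y ∈ ΩO := by
      intro w hw
      have := h.convex_outer.combo_closure_interior_mem_interior (hD hw).1
        (h.isOpen_outer.interior_eq.symm ▸ hyO) (a := 1 - η) (b := η) (by linarith [e3.2]) e3.1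
        (by ring)
      rwa [h.isOpen_outer.interior_eq] at this
    have hinD : ∀ w ∈ D, (1 - η) • w + η • y ∈ D := fun w hw =>
      hDc hw hyD (by linarith [e3.2]) e3.1.le (by ring)
    have := h.radialExtension_combo hG hp (hin y₁ h₁) (hin y₂ h₂)
      (hdisj (hDc.segment_subset (hinD y₁ h₁) (hinD y₂ h₂))) e1 e2 ha hb hab
    have hcomb : a • ((1 - η) • y₁ + η • y) + b • ((1 - η) • y₂ + η • y) = y := by
      have h1 : y = (1 - η) • y + η • y := by module
      calc _ = (1 - η) • (a • y₁ + b • y₂) + (η * (a + b)) • y := by module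
        _ = y := by rw [← hy, hab, mul_one, ← h1]
    rw [hcomb] at this
    convert this using 2
    linear_combination hδ + δ * hab
  · have hyf : a • y₁ + b • y₂ ∈ frontier ΩO :=
      ⟨h.convex_outer.closure (hD h₁).1 (hD h₂).1 ha hb hab, by
        rwa [h.isOpen_outer.interior_eq]⟩
    have heq := h.eq_of_mem_segment_frontier (hD h₁).1 (hD h₂).1 ⟨a, b, ha', hb', hab, rfl⟩ hyf
    subst heq
    rw [← add_smul, hab, one_smul]
    rcases le_total μ₁ μ₂ with hle | hle
    · refine le_trans (EReal.coe_le_coe_iff.2 ?_) hμ₂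
      calc a * μ₁ + b * μ₂ ≤ a * μ₂ + b * μ₂ := by gcongr
        _ = μ₂ := by rw [← add_mul, hab, one_mul]
    · refine le_trans (EReal.coe_le_coe_iff.2 ?_) hμ₁
      calc a * μ₁ + b * μ₂ ≤ a * μ₁ + b * μ₁ := by gcongr
        _ = μ₁ := by rw [← add_mul, hab, one_mul]

theorem minLocallyConcave_le (h : AdmissiblePair ΩO ΩI) (hd : 2 ≤ d)
    {f : EuclideanSpace ℝ (Fin d) → ℝ} (hf : BddBelow (f '' frontier ΩO))
    {x : EuclideanSpace ℝ (Fin d)} (hx : x ∉ convexHull ℝ ΩI) :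
    minLocallyConcave ΩO (closure ΩO \ interior (convexHull ℝ ΩI)) f x ≤
      minLocallyConcave ΩO (closure ΩO \ convexHull ℝ ΩI) f x := by
  obtain ⟨m, hm⟩ := hf
  obtain ⟨p, hp⟩ := h.nonempty_interior
  refine le_sInf ?_
  rintro _ ⟨G, hG, hGf, rfl⟩
  have hC := h.isClosed_hull hd
  have hmG := h.lower_bound_of_isClosed hd hC hG (m := m) fun z hz => by
    rw [hGf z hz]
    exact EReal.coe_le_coe_iff.2 (hm (mem_image_of_mem f hz))
  refine le_trans (sInf_le ⟨radialExtension ΩO p G,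
    h.radialExtension_locallyConcaveOn hC hG hmG hp, fun z hz => ?_, rfl⟩)
    (h.radialExtension_le hC hG hmG p hx)
  rw [radialExtension, if_neg, hGf z hz]
  intro hzO
  exact hz.2 (h.isOpen_outer.interior_eq.symm ▸ hzO)

end AdmissiblePair

end

/-! ### Averages, Lebesgue points, and avoiding the hull on one side -/

section
section Averages
variable {E : Type*} [NormedAddCommGroup E] [NormedSpace ℝ E]

/-- The average of `ψ` over the interval with end points `a < b`. -/
noncomputable def avg (ψ : ℝ → E) (a b : ℝ) : E := (b - a)⁻¹ • ∫ x in a..b, ψ x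

theorem setAverage_Icc_eq_avg (ψ : ℝ → E) {a b : ℝ} (hab : a ≤ b) :
    ⨍ x in Icc a b, ψ x = avg ψ a b := by
  rw [avg, setAverage_eq, intervalIntegral.integral_of_le hab, integral_Icc_eq_integral_Ioc,
    Real.volume_real_Icc_of_le hab]

theorem avg_congr {ψ φ : ℝ → E} {a b : ℝ} (hab : a ≤ b) (h : ∀ x ∈ Icc a b, ψ x = φ x) :
    avg ψ a b = avg φ a b := by
  rw [avg, avg, intervalIntegral.integral_congr]
  rwa [uIcc_of_le hab]

theorem avg_eq_sub {ψ : ℝ → E} (hψ : Integrable ψ) (a b : ℝ) :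
    avg ψ a b = (b - a)⁻¹ • ((∫ x in (0 : ℝ)..b, ψ x) - ∫ x in (0 : ℝ)..a, ψ x) := by
  rw [avg, intervalIntegral.integral_interval_sub_left hψ.intervalIntegrable
    hψ.intervalIntegrable]

theorem continuousOn_avg {ψ : ℝ → E} (hψ : Integrable ψ) :
    ContinuousOn (fun p : ℝ × ℝ => avg ψ p.1 p.2) {p | p.1 < p.2} := by
  have hP : Continuous fun b => ∫ x in (0 : ℝ)..b, ψ x :=
    intervalIntegral.continuous_primitive (fun a b => hψ.intervalIntegrable) 0
  simp only [avg_eq_sub hψ]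
  refine ContinuousOn.smul (ContinuousOn.inv₀ (by fun_prop) fun p hp => ?_) ?_
  · exact (sub_pos.2 hp).ne'
  · exact ((hP.comp continuous_snd).sub (hP.comp continuous_fst)).continuousOn

theorem avg_smul_eq {ψ : ℝ → E} {a b : ℝ} (hab : a < b) :
    (b - a) • avg ψ a b = ∫ x in a..b, ψ x := by
  rw [avg, smul_smul, mul_inv_cancel₀ (sub_pos.2 hab).ne', one_smul]

theorem avg_eq_combo {ψ : ℝ → E} (hψ : Integrable ψ) {a t b : ℝ} (hat : a < t) (htb : t < b) :
    avg ψ a b = ((t - a) / (b - a)) • avg ψ a t + ((b - t) / (b - a)) • avg ψ t b := by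
  rw [div_eq_inv_mul, div_eq_inv_mul, mul_smul, mul_smul, avg_smul_eq hat, avg_smul_eq htb,
    ← smul_add, intervalIntegral.integral_add_adjacent_intervals hψ.intervalIntegrable
      hψ.intervalIntegrable, avg]

theorem avg_comp_neg (ψ : ℝ → E) (a b : ℝ) :
    avg (fun x => ψ (-x)) (-b) (-a) = avg ψ a b := by
  rw [avg, avg, intervalIntegral.integral_comp_neg, neg_neg, neg_neg]
  congr 2
  ring

theorem avg_mem [CompleteSpace E] {ψ : ℝ → E} (hψ : Integrable ψ) {S : Set E} (hS : Convex ℝ S)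
    (hSc : IsClosed S) {a b : ℝ} (hab : a < b) (h : ∀ᵐ x, x ∈ Icc a b → ψ x ∈ S) :
    avg ψ a b ∈ S := by
  rw [← setAverage_Icc_eq_avg ψ hab.le]
  refine hS.set_average_mem hSc ?_ ?_ ?_ hψ.integrableOn
  · simp [hab]
  · simp
  · exact (ae_restrict_iff' measurableSet_Icc).2 h

theorem hasDerivAt_slope_near {P : ℝ → E} {P' : E} {p : ℝ} (hP : HasDerivAt P P' p) {ε : ℝ}
    (hε : 0 < ε) : ∃ δ > 0, ∀ a b, a ≤ p → p ≤ b → a < b → p - δ < a → b < p + δ →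
      ‖(b - a)⁻¹ • (P b - P a) - P'‖ ≤ ε := by
  have h := (hasDerivAt_iff_isLittleO.1 hP).def hε
  obtain ⟨δ, hδ, hb⟩ := Metric.eventually_nhds_iff.1 h
  refine ⟨δ, hδ, fun a b hap hpb hab ha hb' => ?_⟩
  have h1 := hb (y := a) (by rw [Real.dist_eq, abs_lt]; constructor <;> linarith)
  have h2 := hb (y := b) (by rw [Real.dist_eq, abs_lt]; constructor <;> linarith)
  rw [Real.norm_of_nonpos (by linarith)] at h1
  rw [Real.norm_of_nonneg (by linarith)] at h2
  have hpos : 0 < b - a := sub_pos.2 hab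
  have h3 : (b - a)⁻¹ • (P b - P a) - P' =
      (b - a)⁻¹ • ((P b - P p - (b - p) • P') - (P a - P p - (a - p) • P')) := by
    have : P' = (b - a)⁻¹ • ((b - a) • P') := by
      rw [smul_smul, inv_mul_cancel₀ hpos.ne', one_smul]
    nth_rewrite 1 [this]
    rw [← smul_sub]
    congr 1
    module
  rw [h3, norm_smul, norm_inv, Real.norm_of_nonneg hpos.le, inv_mul_le_iff₀ hpos]
  calc _ ≤ _ := norm_sub_le _ _
    _ ≤ ε * (b - p) + ε * -(a - p) := add_le_add h2 h1
    _ = (b - a) * ε := by ring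

/-- At `p`, averages over intervals that contain `p` and shrink to it converge to `ψ p`. -/
def IsAveragePoint (ψ : ℝ → E) (p : ℝ) : Prop :=
  ∀ ε > 0, ∃ δ > 0, ∀ a b, a ≤ p → p ≤ b → a < b → p - δ < a → b < p + δ →
    ‖avg ψ a b - ψ p‖ ≤ ε

theorem ae_isAveragePoint [CompleteSpace E] {ψ : ℝ → E} (hψ : Integrable ψ) :
    ∀ᵐ p, IsAveragePoint ψ p := by
  filter_upwards [LocallyIntegrable.ae_hasDerivAt_integral hψ.locallyIntegrable] with p hp ε hε
  obtain ⟨δ, hδ, h⟩ := hasDerivAt_slope_near (hp 0) hε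
  refine ⟨δ, hδ, fun a b => ?_⟩
  rw [avg_eq_sub hψ]
  exact h a b

theorem IsAveragePoint.tendsto {ψ : ℝ → E} {p : ℝ} (h : IsAveragePoint ψ p) {ι : Type*}
    {F : Filter ι} {a b : ι → ℝ} (ha : Tendsto a F (𝓝 p)) (hb : Tendsto b F (𝓝 p))
    (hab : ∀ᶠ i in F, a i ≤ p ∧ p ≤ b i ∧ a i < b i) :
    Tendsto (fun i => avg ψ (a i) (b i)) F (𝓝 (ψ p)) := by
  refine Metric.tendsto_nhds.2 fun ε hε => ?_
  obtain ⟨δ, hδ, hnear⟩ := h (ε / 2) (half_pos hε)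
  filter_upwards [hab, ha.eventually (lt_mem_nhds (sub_lt_self p hδ)),
    hb.eventually (gt_mem_nhds (lt_add_of_pos_right p hδ))] with i h1 h2 h3
  rw [dist_eq_norm]
  exact (hnear _ _ h1.1 h1.2.1 h1.2.2 h2 h3).trans_lt (half_lt_self hε)

end Averages

theorem le_avg {k : ℝ → ℝ} (hk : Integrable k) {a b c : ℝ} (hab : a < b)
    (h : ∀ᵐ x, x ∈ Icc a b → c ≤ k x) : c ≤ avg k a b :=
  avg_mem hk (S := Ici c) (convex_Ici c) isClosed_Ici hab h

/-- The Vitali–Carathéodory theorem. The last clause holds at every `p`, so values of `φ` chosen on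
a null set still constrain `k` nearby; this is how exceptional points are excluded. -/
theorem exists_majorant {φ : ℝ → ℝ} (hφ : Integrable φ) {ε : ℝ} (hε : 0 < ε) :
    ∃ k : ℝ → ℝ, Integrable k ∧ φ ≤ᵐ[volume] k ∧ ∫ x, k x < (∫ x, φ x) + ε ∧
      ∀ p, ∃ δ > 0, ∀ a b, p - δ < a → a < b → b < p + δ → φ p ≤ avg k a b := by
  obtain ⟨g, hlt, hlsc, hint, htop, hI⟩ := exists_lt_lowerSemicontinuous_integral_lt φ hφ hε
  refine ⟨fun x => (g x).toReal, hint, ?_, hI, fun p => ?_⟩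
  · filter_upwards [htop] with x hx
    have := EReal.toReal_le_toReal (hlt x).le (EReal.coe_ne_bot _) hx.ne
    simpa using this
  · obtain ⟨δ, hδ, hb⟩ := Metric.eventually_nhds_iff.1 (hlsc p _ (hlt p))
    refine ⟨δ, hδ, fun a b ha hab hb' => le_avg hint hab ?_⟩
    filter_upwards [htop] with x hx hxab
    have h1 := hb (y := x) (by
      rw [Real.dist_eq, abs_lt]
      constructor <;> linarith [hxab.1, hxab.2])
    have := EReal.toReal_le_toReal h1.le (EReal.coe_ne_bot _) hx.ne
    simpa using this

theorem intervalIntegral_le_add_of_integral_lt {φ k : ℝ → ℝ} (hφ : Integrable φ)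
    (hk : Integrable k) (hle : φ ≤ᵐ[volume] k) {ε : ℝ} (hlt : ∫ x, k x < (∫ x, φ x) + ε)
    {a b : ℝ} (hab : a ≤ b) : ∫ x in a..b, k x ≤ (∫ x in a..b, φ x) + ε := by
  have h1 : ∫ x in Ioc a b, (k x - φ x) ≤ ∫ x, (k x - φ x) :=
    setIntegral_le_integral (hk.sub hφ) (by
      filter_upwards [hle] with x hx
      exact sub_nonneg.2 hx)
  rw [integral_sub hk hφ, integral_sub hk.integrableOn hφ.integrableOn] at h1
  rw [intervalIntegral.integral_of_le hab, intervalIntegral.integral_of_le hab]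
  linarith

/-- A primitive that becomes negative has a strict record minimum at a point of any given set of
full measure. -/
theorem exists_record {g : ℝ → ℝ} (hg : Integrable g) {Q : ℝ → Prop} (hQ : ∀ᵐ x, Q x) {a t₁ : ℝ}
    (hat : a < t₁) (hneg : ∫ x in a..t₁, g x < 0) :
    ∃ t ∈ Ioc a t₁, Q t ∧ ∀ s ∈ Ico a t, ∫ x in s..t, g x < 0 := by
  classical
  -- The value `1` does not affect integrals, but where `Q` fails it makes averages of the majorant
  -- positive, which no record minimum permits.
  let φ : ℝ → ℝ := fun x => if Q x then g x else 1
  have hφg : φ =ᵐ[volume] g := by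
    filter_upwards [hQ] with x hx
    simp [φ, hx]
  have hφ : Integrable φ := hg.congr hφg.symm
  obtain ⟨k, hk, hφk, hI, hloc⟩ := exists_majorant hφ (half_pos (neg_pos.2 hneg))
  have hgk : g ≤ᵐ[volume] k := hφg.symm.le.trans hφk
  have hK : Continuous fun t => ∫ x in a..t, k x :=
    intervalIntegral.continuous_primitive (fun a b => hk.intervalIntegrable) a
  have hKt₁ : ∫ x in a..t₁, k x < 0 := by
    rw [integral_congr_ae hφg] at hI
    have := intervalIntegral_le_add_of_integral_lt hg hk hgk hI hat.le
    linarith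
  obtain ⟨t₂, ht₂, hmin⟩ := isCompact_Icc.exists_isMinOn (nonempty_Icc.2 hat.le) hK.continuousOn
  -- The set of minimum points of the primitive of `k`; its least element is a strict record, and `g
  -- ≤ k` hands the record over to `g`.
  let T := Icc a t₁ ∩ {t | ∫ x in a..t, k x ≤ ∫ x in a..t₂, k x}
  have hT : IsCompact T := isCompact_Icc.inter_right (isClosed_le hK continuous_const)
  obtain ⟨t, ⟨ht, htm⟩, hleast⟩ := hT.exists_isLeast ⟨t₂, ht₂, show ∫ x in a..t₂, k x ≤ ∫ x in a..t₂, k x from le_rfl⟩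
  have hKt : ∫ x in a..t, k x < 0 := by
    refine lt_of_le_of_lt htm (lt_of_le_of_lt ?_ hKt₁)
    exact hmin (right_mem_Icc.2 hat.le)
  have hta : a < t := by
    refine lt_of_le_of_ne ht.1 ?_
    rintro rfl
    simp at hKt
  have hrec : ∀ s ∈ Ico a t, ∫ x in s..t, k x < 0 := by
    intro s hs
    by_contra! hcon
    have hadd := intervalIntegral.integral_add_adjacent_intervals
      (hk.intervalIntegrable (a := a) (b := s)) (hk.intervalIntegrable (a := s) (b := t))
    have hsT : s ∈ T := by
      refine ⟨⟨hs.1, hs.2.le.trans ht.2⟩, ?_⟩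
      have h1 : ∫ x in a..t, k x ≤ ∫ x in a..t₂, k x := htm
      change ∫ x in a..s, k x ≤ ∫ x in a..t₂, k x
      linarith
    exact (hleast hsT).not_gt hs.2
  refine ⟨t, ⟨hta, ht.2⟩, ?_, fun s hs => ?_⟩
  · by_contra hQt
    obtain ⟨δ, hδ, hb⟩ := hloc t
    set s := max a (t - δ / 2) with hs
    have hst : s < t := max_lt hta (by linarith)
    have h1 := hb s t ((by linarith : t - δ < t - δ / 2).trans_le (le_max_right _ _)) hst
      (by linarith)
    simp only [φ, hQt, if_false, avg, smul_eq_mul] at h1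
    have h2 := hrec s ⟨le_max_left _ _, hst⟩
    have h3 := mul_neg_of_pos_of_neg (inv_pos.2 (sub_pos.2 hst)) h2
    linarith
  · exact lt_of_le_of_lt (intervalIntegral.integral_mono_ae hs.2.le hg.intervalIntegrable
      hk.intervalIntegrable hgk) (hrec s hs)

variable {d : ℕ} {ΩO ΩI : Set (EuclideanSpace ℝ (Fin d))}

namespace AdmissiblePair

/-- If every `t` fails, then `z` is on a flat boundary piece `l = l z` off `ΩI`, and all averages
over `[a, t]` have `l < l z`. Let `t₀` be a record minimum, at a Lebesgue point, of the primitive of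
`l ∘ ψ - l z`. Lowering `t` from `t₁` to `t₀`, and then raising the left end from `a` to `t₀`, keeps
averages below `l z` and off `ΩI`, so they cannot cross the frontier of `ω`. Their limit `ψ t₀` is
then in the closed hull, inside `ΩO`. -/
theorem exists_left_avoiding (h : AdmissiblePair ΩO ΩI) {ψ : ℝ → EuclideanSpace ℝ (Fin d)}
    (hψ : Integrable ψ) {a b : ℝ} (hab : a < b) (hfr : ∀ x ∈ Icc a b, ψ x ∈ frontier ΩO)
    (havg : ∀ s t, a ≤ s → s < t → t ≤ b → avg ψ s t ∉ ΩI)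
    (hz : avg ψ a b ∉ interior (convexHull ℝ ΩI)) :
    ∃ t ∈ Ioo a b, Disjoint (segment ℝ (avg ψ a b) (avg ψ a t)) (interior (convexHull ℝ ΩI)) := by
  by_contra! hcon
  have hcontb : ContinuousOn (fun t => avg ψ a t) (Ioi a) :=
    (continuousOn_avg hψ).comp (by fun_prop : ContinuousOn (fun t : ℝ => (a, t)) (Ioi a))
      fun t ht => ht
  have hlimb : Tendsto (fun t => avg ψ a t) (𝓝[<] b) (𝓝 (avg ψ a b)) :=
    (hcontb.continuousAt (Ioi_mem_nhds hab)).tendsto.mono_left nhdsWithin_le_nhds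
  set z := avg ψ a b with hzdef
  have hnear : ∀ r > 0, ∃ t ∈ Ioo a b, avg ψ a t ∈ ball z r := fun r hr => by
    obtain ⟨t, h1, h2⟩ := ((hlimb.eventually (ball_mem_nhds z hr)).and
      (Ioo_mem_nhdsLT hab)).exists
    exact ⟨t, h2, h1⟩
  by_cases hzC : z ∈ closure (convexHull ℝ ΩI)
  swap
  · obtain ⟨r, hr, hball⟩ := Metric.isOpen_iff.1 isClosed_closure.isOpen_compl z hzC
    obtain ⟨t, ht, htr⟩ := hnear r hr
    refine hcon t ht (disjoint_left.2 fun w hw hwC => ?_)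
    exact hball ((convex_ball z r).segment_subset (mem_ball_self hr) htr hw)
      (subset_closure (interior_subset hwC))
  obtain ⟨r, hr, l, ω, hl, hle, -, hωfr, hωC, hballω, hhalf⟩ :=
    h.exists_facet ⟨hzC, hz⟩ (havg a b le_rfl hab le_rfl)
  have hlt : ∀ t ∈ Ioo a b, l (avg ψ a t) < l z := by
    intro t ht
    obtain ⟨w, ⟨α, β, hα, hβ, hαβ, rfl⟩, hwC⟩ := not_disjoint_iff.1 (hcon t ht)
    have h1 := lt_on_interior_of_le hl (fun w hw => hle w (subset_closure hw)) _ hwC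
    simp only [map_add, map_smul, smul_eq_mul] at h1
    by_contra! hge
    have h2 : l z = α * l z + β * l z := by rw [← add_mul, hαβ, one_mul]
    nlinarith [mul_le_mul_of_nonneg_left hge hβ]
  obtain ⟨t₁, ht₁, ht₁r⟩ := hnear r hr
  have ht₁ω : avg ψ a t₁ ∈ ω := hballω ⟨ht₁r, hhalf ⟨ht₁r, hlt t₁ ht₁⟩⟩
  let g : ℝ → ℝ := (Icc a b).indicator fun x => l (ψ x) - l z
  have hlψ : Integrable fun x => l (ψ x) := l.integrable_comp hψ
  have hg : Integrable g := by
    refine IntegrableOn.integrable_indicator ?_ measurableSet_Icc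
    exact hlψ.integrableOn.sub (integrableOn_const (by simp))
  have hgint : ∀ s t, a ≤ s → s < t → t ≤ b →
      ∫ x in s..t, g x = (t - s) * (l (avg ψ s t) - l z) := by
    intro s t has hst htb
    have h1 : ∫ x in s..t, g x = ∫ x in s..t, (l (ψ x) - l z) := by
      refine intervalIntegral.integral_congr fun x hx => ?_
      rw [uIcc_of_le hst.le] at hx
      exact indicator_of_mem (show x ∈ Icc a b from ⟨has.trans hx.1, hx.2.trans htb⟩) _
    rw [h1, intervalIntegral.integral_sub hlψ.intervalIntegrable intervalIntegrable_const,
      l.intervalIntegral_comp_comm hψ.intervalIntegrable, ← avg_smul_eq hst,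
      intervalIntegral.integral_const, map_smul, smul_eq_mul, smul_eq_mul]
    ring
  obtain ⟨t₀, ht₀, hleb, hrec⟩ := exists_record hg (ae_isAveragePoint hψ) ht₁.1 (by
    rw [hgint a t₁ le_rfl ht₁.1 ht₁.2.le]
    exact mul_neg_of_pos_of_neg (sub_pos.2 ht₁.1) (sub_neg.2 (hlt t₁ ht₁)))
  have ht₀b : t₀ < b := ht₀.2.trans_lt ht₁.2
  have hlt₀ : ∀ s ∈ Ico a t₀, l (avg ψ s t₀) < l z := by
    intro s hs
    have h1 := hrec s hs
    rw [hgint s t₀ hs.1 hs.2 ht₀b.le] at h1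
    exact sub_neg.1 (neg_of_mul_neg_right h1 (sub_nonneg.2 hs.2.le))
  have hω₀ : avg ψ a t₀ ∈ ω := by
    have hpre : IsPreconnected ((fun t => avg ψ a t) '' Icc t₀ t₁) :=
      isPreconnected_Icc.image _ (hcontb.mono fun t ht => ht₀.1.trans_le ht.1)
    refine IsPreconnected.subset_of_disjoint_frontier hpre ?_ ⟨_, ⟨t₁, ⟨ht₀.2, le_rfl⟩, rfl⟩, ht₁ω⟩
      ⟨t₀, ⟨le_rfl, ht₀.2⟩, rfl⟩
    refine disjoint_left.2 ?_
    rintro _ ⟨t, ht, rfl⟩ hf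
    have hat : a < t := ht₀.1.trans_le ht.1
    have htb : t < b := ht.2.trans_lt ht₁.2
    exact (hlt t ⟨hat, htb⟩).ne (hωfr _ hf (havg a t le_rfl hat htb.le))
  have hconts : ContinuousOn (fun s => avg ψ s t₀) (Ico a t₀) :=
    (continuousOn_avg hψ).comp (by fun_prop : ContinuousOn (fun s : ℝ => (s, t₀)) (Ico a t₀))
      fun s hs => hs.2
  have hωall : (fun s => avg ψ s t₀) '' Ico a t₀ ⊆ ω := by
    refine IsPreconnected.subset_of_disjoint_frontier (isPreconnected_Ico.image _ hconts) ?_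
      ⟨_, ⟨a, ⟨le_rfl, ht₀.1⟩, rfl⟩, hω₀⟩
    refine disjoint_left.2 ?_
    rintro _ ⟨s, hs, rfl⟩ hf
    exact (hlt₀ s hs).ne (hωfr _ hf (havg s t₀ hs.1 hs.2 ht₀b.le))
  have hlim : Tendsto (fun s => avg ψ s t₀) (𝓝[<] t₀) (𝓝 (ψ t₀)) := by
    refine hleb.tendsto (tendsto_id.mono_right nhdsWithin_le_nhds) tendsto_const_nhds ?_
    filter_upwards [self_mem_nhdsWithin] with s hs
    exact ⟨le_of_lt hs, le_rfl, hs⟩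
  have hcl : ψ t₀ ∈ closure (convexHull ℝ ΩI) := by
    refine mem_closure_of_tendsto hlim ?_
    filter_upwards [Ico_mem_nhdsLT ht₀.1] with s hs
    exact interior_subset (hωC (hωall ⟨s, hs, rfl⟩))
  have hO := h.closure_subset hcl
  exact (hfr t₀ ⟨ht₀.1.le, ht₀b.le⟩).2 (h.isOpen_outer.interior_eq.symm ▸ hO)

end AdmissiblePair

end

/-! ### Shrinking families of intervals, and the splitting lemma -/

section
/-- A family of intervals that is closed under nondegenerate limits, each member of which
contains a strictly shorter member, contains intervals that shrink to a point. -/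
theorem exists_shrinking_intervals {S : Set (ℝ × ℝ)} (hlt : ∀ p ∈ S, p.1 < p.2)
    (hlim : ∀ (u : ℕ → ℝ × ℝ) (p : ℝ × ℝ), (∀ n, u n ∈ S) → Tendsto u atTop (𝓝 p) →
      p.1 < p.2 → p ∈ S)
    (hsplit : ∀ p ∈ S, ∃ q ∈ S, p.1 ≤ q.1 ∧ q.2 ≤ p.2 ∧ q.2 - q.1 < p.2 - p.1)
    (hne : S.Nonempty) :
    ∃ (u : ℕ → ℝ × ℝ) (x : ℝ), (∀ n, u n ∈ S) ∧ (∀ n, (u n).1 ≤ x ∧ x ≤ (u n).2) ∧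
      Tendsto (fun n => (u n).1) atTop (𝓝 x) ∧ Tendsto (fun n => (u n).2) atTop (𝓝 x) := by
  have hstep : ∀ (n : ℕ) (p : S), ∃ q : S, p.1.1 ≤ q.1.1 ∧ q.1.2 ≤ p.1.2 ∧
      ∀ r ∈ S, p.1.1 ≤ r.1 → r.2 ≤ p.1.2 → q.1.2 - q.1.1 ≤ r.2 - r.1 + 1 / ((n : ℝ) + 1) := by
    intro n p
    -- Greedy choice: the next interval is within `1 / (n + 1)` of the shortest length available. A
    -- strictly shorter member inside a nondegenerate limit would then be shorter than allowed.
    let A := {t : ℝ | ∃ r ∈ S, p.1.1 ≤ r.1 ∧ r.2 ≤ p.1.2 ∧ t = r.2 - r.1}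
    have hA : A.Nonempty := ⟨_, p.1, p.2, le_rfl, le_rfl, rfl⟩
    have hbdd : BddBelow A := ⟨0, by
      rintro _ ⟨r, hr, -, -, rfl⟩
      exact (sub_pos.2 (hlt r hr)).le⟩
    obtain ⟨_, ⟨q, hq, hq1, hq2, rfl⟩, hqlt⟩ := Real.lt_sInf_add_pos hA
      (show (0 : ℝ) < 1 / ((n : ℝ) + 1) by positivity)
    refine ⟨⟨q, hq⟩, hq1, hq2, fun r hr hr1 hr2 => hqlt.le.trans ?_⟩
    have := csInf_le hbdd ⟨r, hr, hr1, hr2, rfl⟩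
    linarith
  choose next hn1 hn2 hn3 using hstep
  obtain ⟨p₀, hp₀⟩ := hne
  let v : ℕ → S := fun n => Nat.rec ⟨p₀, hp₀⟩ (fun n p => next n p) n
  have hmono : Monotone fun n => (v n).1.1 := monotone_nat_of_le_succ fun n => hn1 n (v n)
  have hanti : Antitone fun n => (v n).1.2 := antitone_nat_of_succ_le fun n => hn2 n (v n)
  have hvlt : ∀ i j, (v i).1.1 < (v j).1.2 := fun i j =>
    (hmono (le_max_left i j)).trans_lt ((hlt _ (v (max i j)).2).trans_le
      (hanti (le_max_right i j)))
  have hb1 : BddAbove (range fun n => (v n).1.1) := ⟨(v 0).1.2, by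
    rintro _ ⟨n, rfl⟩
    exact (hvlt n 0).le⟩
  have hb2 : BddBelow (range fun n => (v n).1.2) := ⟨(v 0).1.1, by
    rintro _ ⟨n, rfl⟩
    exact (hvlt 0 n).le⟩
  have ha := tendsto_atTop_ciSup hmono hb1
  have hb := tendsto_atTop_ciInf hanti hb2
  set a := ⨆ n, (v n).1.1
  set b := ⨅ n, (v n).1.2
  have hle_a : ∀ n, (v n).1.1 ≤ a := fun n => le_ciSup hb1 n
  have hle_b : ∀ n, b ≤ (v n).1.2 := fun n => ciInf_le hb2 n
  have hab : a ≤ b := ciSup_le fun i => le_ciInf fun j => (hvlt i j).le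
  rcases hab.eq_or_lt with heq | hab
  · exact ⟨fun n => (v n).1, a, fun n => (v n).2, fun n => ⟨hle_a n, heq ▸ hle_b n⟩, ha, heq ▸ hb⟩
  · exfalso
    have hmem : (a, b) ∈ S := hlim (fun n => (v n).1) (a, b) (fun n => (v n).2)
      (ha.prodMk_nhds hb) hab
    obtain ⟨q, hq, hq1, hq2, hq3⟩ := hsplit _ hmem
    have hall : ∀ n : ℕ, b - a ≤ q.2 - q.1 + 1 / ((n : ℝ) + 1) := fun n => by
      have h1 := hn3 n (v n) q hq ((hle_a n).trans hq1) (hq2.trans (hle_b n))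
      have h2 := hle_a (n + 1)
      have h3 := hle_b (n + 1)
      change (v (n + 1)).1.2 - (v (n + 1)).1.1 ≤ _ at h1
      linarith
    have hl : Tendsto (fun n : ℕ => q.2 - q.1 + 1 / ((n : ℝ) + 1)) atTop (𝓝 (q.2 - q.1 + 0)) :=
      tendsto_const_nhds.add tendsto_one_div_add_atTop_nhds_zero_nat
    have := ge_of_tendsto' hl hall
    simp only at hq3
    linarith

variable {d : ℕ} {ΩO ΩI : Set (EuclideanSpace ℝ (Fin d))}
  {G : EuclideanSpace ℝ (Fin d) → EReal}

theorem isOpen_setOf_segment_meets {E : Type*} [NormedAddCommGroup E] [NormedSpace ℝ E]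
    {U : Set E} (hU : IsOpen U) (z : E) {x : ℝ → E} {I : Set ℝ} (hI : IsOpen I)
    (hx : ContinuousOn x I) : IsOpen {t ∈ I | ¬ Disjoint (segment ℝ z (x t)) U} := by
  have : {t ∈ I | ¬ Disjoint (segment ℝ z (x t)) U} =
      ⋃ θ ∈ Icc (0 : ℝ) 1, I ∩ (fun t => (1 - θ) • z + θ • x t) ⁻¹' U := by
    ext t
    simp only [mem_ofPred_eq, not_disjoint_iff, mem_iUnion, mem_inter_iff, mem_preimage,
      exists_prop]
    constructor
    · rintro ⟨ht, _, ⟨α, β, hα, hβ, hαβ, rfl⟩, hw⟩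
      refine ⟨β, ⟨hβ, by linarith⟩, ht, ?_⟩
      rwa [show 1 - β = α by linarith]
    · rintro ⟨θ, hθ, ht, hw⟩
      exact ⟨ht, _, ⟨1 - θ, θ, sub_nonneg.2 hθ.2, hθ.1, by ring, rfl⟩, hw⟩
  rw [this]
  refine isOpen_biUnion fun θ _ => ?_
  exact (continuousOn_const.add (continuousOn_const.smul hx)).isOpen_inter_preimage hI hU

theorem mem_of_segments_meet {E : Type*} [NormedAddCommGroup E] [NormedSpace ℝ E]
    {U : Set E} (hU : Convex ℝ U) {x₁ x₂ : E} {α β : ℝ} (hα : 0 < α) (hβ : 0 < β)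
    (hαβ : α + β = 1)
    (h₁ : ¬ Disjoint (segment ℝ (α • x₁ + β • x₂) x₁) U)
    (h₂ : ¬ Disjoint (segment ℝ (α • x₁ + β • x₂) x₂) U) : α • x₁ + β • x₂ ∈ U := by
  set z := α • x₁ + β • x₂ with hz
  have hparam : ∀ x, ¬ Disjoint (segment ℝ z x) U → ∃ θ : ℝ, 0 ≤ θ ∧ z + θ • (x - z) ∈ U := by
    intro x hx
    obtain ⟨_, ⟨a, b, -, hb, hab, rfl⟩, hw⟩ := not_disjoint_iff.1 hx
    refine ⟨b, hb, ?_⟩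
    convert hw using 1
    rw [show a = 1 - b by linarith]
    module
  obtain ⟨θ₁, hθ₁, hp⟩ := hparam x₁ h₁
  obtain ⟨θ₂, hθ₂, hq⟩ := hparam x₂ h₂
  rcases hθ₁.eq_or_lt with rfl | hθ₁
  · simpa using hp
  rcases hθ₂.eq_or_lt with rfl | hθ₂
  · simpa using hq
  have hD : 0 < α / θ₁ + β / θ₂ := by positivity
  -- The points of `U` lie on opposite sides of `z`; weights proportional to `α / θ₁` and `β / θ₂`
  -- cancel their displacements.
  have hmem := hU hp hq (a := α / θ₁ / (α / θ₁ + β / θ₂)) (b := β / θ₂ / (α / θ₁ + β / θ₂))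
    (by positivity) (by positivity) (by field_simp)
  have h0 : α • (x₁ - z) + β • (x₂ - z) = 0 := by
    calc _ = (α • x₁ + β • x₂) - (α + β) • z := by module
      _ = 0 := by rw [hαβ, one_smul, ← hz, sub_self]
  convert hmem using 1
  have hs : α / θ₁ / (α / θ₁ + β / θ₂) + β / θ₂ / (α / θ₁ + β / θ₂) = 1 := by
    rw [← add_div, div_self hD.ne']
  symm
  calc (α / θ₁ / (α / θ₁ + β / θ₂)) • (z + θ₁ • (x₁ - z)) +
        (β / θ₂ / (α / θ₁ + β / θ₂)) • (z + θ₂ • (x₂ - z))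
      = (α / θ₁ / (α / θ₁ + β / θ₂) + β / θ₂ / (α / θ₁ + β / θ₂)) • z +
        ((α / θ₁ * θ₁ / (α / θ₁ + β / θ₂)) • (x₁ - z) +
          (β / θ₂ * θ₂ / (α / θ₁ + β / θ₂)) • (x₂ - z)) := by module
    _ = z + (α / θ₁ + β / θ₂)⁻¹ • (α • (x₁ - z) + β • (x₂ - z)) := by
        rw [hs, one_smul, div_mul_cancel₀ _ hθ₁.ne', div_mul_cancel₀ _ hθ₂.ne', smul_add,
          smul_smul, smul_smul, div_eq_inv_mul α, div_eq_inv_mul β (_ + _)]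
    _ = z := by rw [h0, smul_zero, add_zero]

theorem disjoint_segment_of_halves {E : Type*} [NormedAddCommGroup E] [NormedSpace ℝ E]
    {U : Set E} {x₁ x₂ z : E} (hz : z ∈ segment ℝ x₁ x₂)
    (h₁ : Disjoint (segment ℝ z x₁) U) (h₂ : Disjoint (segment ℝ z x₂) U) :
    Disjoint (segment ℝ x₁ x₂) U := by
  refine disjoint_left.2 fun w hw hwU => ?_
  rw [segment_eq_image_lineMap] at hz hw
  obtain ⟨s, hs, rfl⟩ := hz
  obtain ⟨t, ht, rfl⟩ := hw
  rcases le_total t s with hts | hst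
  · refine disjoint_left.1 h₁ ?_ hwU
    have h0 : t ∈ segment ℝ s 0 := by
      rw [segment_symm, segment_eq_Icc hs.1]
      exact ⟨ht.1, hts⟩
    have := mem_image_of_mem (AffineMap.lineMap x₁ x₂ : ℝ →ᵃ[ℝ] E) h0
    rwa [image_segment, AffineMap.lineMap_apply_zero] at this
  · refine disjoint_left.1 h₂ ?_ hwU
    have h1 : t ∈ segment ℝ s 1 := by
      rw [segment_eq_Icc hs.2]
      exact ⟨hst, ht.2⟩
    have := mem_image_of_mem (AffineMap.lineMap x₁ x₂ : ℝ →ᵃ[ℝ] E) h1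
    rwa [image_segment, AffineMap.lineMap_apply_one] at this

namespace AdmissiblePair

/-- The obstacle sets `L` and `R` are open, and disjoint by `mem_of_segments_meet`. If they covered
the connected interval, one of them would be all of it, against `exists_left_avoiding` or its mirror
image. -/
theorem exists_split (h : AdmissiblePair ΩO ΩI) {ψ : ℝ → EuclideanSpace ℝ (Fin d)}
    (hψ : Integrable ψ) {a b : ℝ} (hab : a < b) (hfr : ∀ x ∈ Icc a b, ψ x ∈ frontier ΩO)
    (havg : ∀ s t, a ≤ s → s < t → t ≤ b → avg ψ s t ∉ ΩI)
    (hz : avg ψ a b ∉ interior (convexHull ℝ ΩI)) :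
    ∃ t ∈ Ioo a b, Disjoint (segment ℝ (avg ψ a t) (avg ψ t b))
      (interior (convexHull ℝ ΩI)) := by
  have hconv := (convex_convexHull ℝ ΩI).interior
  set z := avg ψ a b with hzdef
  let L := {t ∈ Ioo a b | ¬ Disjoint (segment ℝ z (avg ψ a t)) (interior (convexHull ℝ ΩI))}
  let R := {t ∈ Ioo a b | ¬ Disjoint (segment ℝ z (avg ψ t b)) (interior (convexHull ℝ ΩI))}
  have hL : IsOpen L := isOpen_setOf_segment_meets isOpen_interior z isOpen_Ioo
    ((continuousOn_avg hψ).comp (by fun_prop : ContinuousOn (fun t : ℝ => (a, t)) (Ioo a b))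
      fun t ht => ht.1)
  have hR : IsOpen R := isOpen_setOf_segment_meets isOpen_interior z isOpen_Ioo
    ((continuousOn_avg hψ).comp (by fun_prop : ContinuousOn (fun t : ℝ => (t, b)) (Ioo a b))
      fun t ht => ht.2)
  have hcombo : ∀ t ∈ Ioo a b, ∃ α β : ℝ, 0 < α ∧ 0 < β ∧ α + β = 1 ∧
      z = α • avg ψ a t + β • avg ψ t b := fun t ht => by
    have hba := sub_pos.2 hab
    refine ⟨(t - a) / (b - a), (b - t) / (b - a), div_pos (sub_pos.2 ht.1) hba,
      div_pos (sub_pos.2 ht.2) hba, ?_, avg_eq_combo hψ ht.1 ht.2⟩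
    rw [← add_div, div_eq_one_iff_eq hba.ne']
    ring
  have hLR : Disjoint L R := by
    refine disjoint_left.2 fun t htL htR => ?_
    obtain ⟨α, β, hα, hβ, hαβ, heq⟩ := hcombo t htL.1
    have h1 := htL.2
    have h2 := htR.2
    rw [heq] at h1 h2
    exact hz (heq ▸ mem_of_segments_meet hconv hα hβ hαβ h1 h2)
  by_contra! hcon
  have hcover : Ioo a b ⊆ L ∪ R := by
    intro t ht
    by_contra hnot
    rw [mem_union, not_or] at hnot
    have h1 : Disjoint (segment ℝ z (avg ψ a t)) (interior (convexHull ℝ ΩI)) := by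
      by_contra hd
      exact hnot.1 ⟨ht, hd⟩
    have h2 : Disjoint (segment ℝ z (avg ψ t b)) (interior (convexHull ℝ ΩI)) := by
      by_contra hd
      exact hnot.2 ⟨ht, hd⟩
    obtain ⟨α, β, hα, hβ, hαβ, heq⟩ := hcombo t ht
    exact hcon t ht (disjoint_segment_of_halves ⟨α, β, hα.le, hβ.le, hαβ, heq.symm⟩ h1 h2)
  rcases isPreconnected_Ioo.subset_or_subset hL hR hLR hcover with hall | hall
  · obtain ⟨t, ht, hd⟩ := h.exists_left_avoiding hψ hab hfr havg hz
    exact (hall ht).2 hd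
  -- The reflection `x ↦ -x` exchanges left and right parts.
  · have hψ' : Integrable fun x => ψ (-x) := hψ.comp_neg
    have hzneg : avg (fun x => ψ (-x)) (-b) (-a) = z := avg_comp_neg ψ a b
    obtain ⟨t, ht, hd⟩ := h.exists_left_avoiding hψ' (neg_lt_neg hab)
      (fun x hx => hfr (-x) ⟨by linarith [hx.2], by linarith [hx.1]⟩)
      (fun s t hs hst ht => by
        have := avg_comp_neg ψ (-t) (-s)
        rw [neg_neg, neg_neg] at this
        rw [this]
        exact havg (-t) (-s) (by linarith) (by linarith) (by linarith))
      (by rwa [hzneg])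
    have hneg := avg_comp_neg ψ (-t) b
    rw [neg_neg] at hneg
    rw [hzneg, hneg] at hd
    exact (hall (a := -t) ⟨by linarith [ht.2], by linarith [ht.1]⟩).2 hd

end AdmissiblePair

end

/-! ### The Bellman induction -/

section
variable {d : ℕ} {ΩO ΩI : Set (EuclideanSpace ℝ (Fin d))}
  {G : EuclideanSpace ℝ (Fin d) → EReal}

theorem tendsto_avg {E : Type*} [NormedAddCommGroup E] [NormedSpace ℝ E] {ψ : ℝ → E}
    (hψ : Integrable ψ) {u : ℕ → ℝ × ℝ} {p : ℝ × ℝ} (hu : Tendsto u atTop (𝓝 p))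
    (hp : p.1 < p.2) : Tendsto (fun n => avg ψ (u n).1 (u n).2) atTop (𝓝 (avg ψ p.1 p.2)) :=
  (((continuousOn_avg hψ).continuousAt
    ((isOpen_lt continuous_fst continuous_snd).mem_nhds hp)).tendsto.comp hu :)

namespace AdmissiblePair

theorem integral_le (h : AdmissiblePair ΩO ΩI) (hd : 2 ≤ d)
    (hG : LocallyConcaveOn (closure ΩO \ interior (convexHull ℝ ΩI)) G)
    {f : EuclideanSpace ℝ (Fin d) → ℝ} (hf : ContinuousOn f (frontier ΩO))
    (hGf : ∀ z ∈ frontier ΩO, G z = (f z : EReal)) {m : ℝ} (hm : ∀ z ∈ frontier ΩO, m ≤ f z)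
    {ψ : ℝ → EuclideanSpace ℝ (Fin d)} (hψ : Integrable ψ)
    (hfr : ∀ x ∈ Icc (0 : ℝ) 1, ψ x ∈ frontier ΩO)
    (havg : ∀ s t : ℝ, 0 ≤ s → s < t → t ≤ 1 → avg ψ s t ∉ ΩI)
    (hx : avg ψ 0 1 ∉ interior (convexHull ℝ ΩI)) {φ : ℝ → ℝ} (hφ : Integrable φ)
    (hφf : ∀ x ∈ Icc (0 : ℝ) 1, φ x ≤ f (ψ x)) :
    ((∫ x in (0 : ℝ)..1, φ x : ℝ) : EReal) ≤ G (avg ψ 0 1) := by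
  classical
  by_contra! hcon
  obtain ⟨r, hr1, hr2⟩ := EReal.lt_iff_exists_real_btwn.1 hcon
  rw [EReal.coe_lt_coe_iff] at hr2
  -- Half of the gap pays for replacing `φ` by `-k`; the other half is the margin in `S`.
  set δ := ((∫ x in (0 : ℝ)..1, φ x) - r) / 2 with hδ
  have hδ0 : 0 < δ := half_pos (sub_pos.2 hr2)
  have hmG := h.lower_bound hd hG (m := m) fun z hz => by
    rw [hGf z hz]
    exact EReal.coe_le_coe_iff.2 (hm z hz)
  -- At a point that is not an average point this forces averages of `-k` down to `m - 1`, below the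
  -- lower bound `m` of `G`, so bad intervals cannot shrink to it.
  let φ' : ℝ → ℝ := fun x => if IsAveragePoint ψ x then -φ x else -(m - 1)
  have hφ' : φ' =ᵐ[volume] fun x => -φ x := by
    filter_upwards [ae_isAveragePoint hψ] with x hx
    simp [φ', hx]
  obtain ⟨k, hk, hφk, hI, hloc⟩ := exists_majorant (hφ.neg.congr hφ'.symm) hδ0
  have hI01 : (∫ x in (0 : ℝ)..1, φ x) - δ ≤ -avg k 0 1 := by
    have h1 := intervalIntegral_le_add_of_integral_lt (hφ.neg.congr hφ'.symm) hk hφk hI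
      zero_le_one
    rw [intervalIntegral.integral_congr_ae (hφ'.mono fun x hx _ => hx),
      intervalIntegral.integral_neg] at h1
    simp only [avg, sub_zero, inv_one, one_smul]
    linarith
  set W := closure ΩO \ interior (convexHull ℝ ΩI) with hW
  have hWc : IsClosed W := isClosed_closure.sdiff isOpen_interior
  have hclos : ∀ a b : ℝ, 0 ≤ a → a < b → b ≤ 1 → avg ψ a b ∈ closure ΩO := by
    intro a b ha hab hb
    refine avg_mem hψ h.convex_outer.closure isClosed_closure hab
      (Eventually.of_forall fun x hx => ?_)
    exact (hfr x ⟨ha.trans hx.1, hx.2.trans hb⟩).1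
  let S : Set (ℝ × ℝ) := {p | (0 ≤ p.1 ∧ p.1 < p.2 ∧ p.2 ≤ 1) ∧ avg ψ p.1 p.2 ∈ W ∧
    G (avg ψ p.1 p.2) ≤ ((-avg k p.1 p.2 - δ : ℝ) : EReal)}
  obtain ⟨u, x, huS, hux, hu1, hu2⟩ : ∃ (u : ℕ → ℝ × ℝ) (x : ℝ), (∀ n, u n ∈ S) ∧
      (∀ n, (u n).1 ≤ x ∧ x ≤ (u n).2) ∧
      Tendsto (fun n => (u n).1) atTop (𝓝 x) ∧ Tendsto (fun n => (u n).2) atTop (𝓝 x) := by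
    refine exists_shrinking_intervals (fun p hp => hp.1.2.1) ?_ ?_ ⟨(0, 1), ?_⟩
    · intro u p hu hup hp
      have h1 : Tendsto (fun n => (u n).1) atTop (𝓝 p.1) := (continuous_fst.tendsto p).comp hup
      have h2 : Tendsto (fun n => (u n).2) atTop (𝓝 p.2) := (continuous_snd.tendsto p).comp hup
      have hψu := tendsto_avg hψ hup hp
      have hku := tendsto_avg hk hup hp
      have hpW : avg ψ p.1 p.2 ∈ W :=
        hWc.mem_of_tendsto hψu (Eventually.of_forall fun n => (hu n).2.1)
      refine ⟨⟨ge_of_tendsto' h1 fun n => (hu n).1.1, hp, le_of_tendsto' h2 fun n => (hu n).1.2.2⟩,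
        hpW, ?_⟩
      by_contra! hlt
      obtain ⟨c, hc1, hc2⟩ := EReal.lt_iff_exists_real_btwn.1 hlt
      rw [EReal.coe_lt_coe_iff] at hc1
      have hlsc := h.lsc hd hG hmG hf hGf hpW.1 c hc2
      have e1 := (tendsto_nhdsWithin_iff.2 ⟨hψu, Eventually.of_forall fun n =>
        (hu n).2.1⟩).eventually hlsc
      have e2 : ∀ᶠ n in atTop, -avg k (u n).1 (u n).2 - δ < c :=
        (hku.neg.sub_const δ).eventually (gt_mem_nhds hc1)
      obtain ⟨n, hn1, hn2⟩ := (e1.and e2).exists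
      exact (EReal.coe_lt_coe_iff.2 hn2).not_ge (hn1.trans (hu n).2.2)
    · rintro ⟨a, b⟩ ⟨⟨ha, hab, hb⟩, habW, hle⟩
      simp only at ha hab hb habW hle ⊢
      obtain ⟨t, ht, hdisj⟩ := h.exists_split hψ hab
        (fun x hx => hfr x ⟨ha.trans hx.1, hx.2.trans hb⟩)
        (fun s t has hst htb => havg s t (ha.trans has) hst (htb.trans hb)) habW.2
      have hc1 := hclos a t ha ht.1 (ht.2.le.trans hb)
      have hc2 := hclos t b (ha.trans ht.1.le) ht.2 hb
      have hseg : segment ℝ (avg ψ a t) (avg ψ t b) ⊆ W := fun z hz =>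
        ⟨h.convex_outer.closure.segment_subset hc1 hc2 hz, disjoint_left.1 hdisj hz⟩
      -- If both halves satisfied the strict opposite inequality, concavity of `G` on `hseg` would
      -- give it for the whole interval, since averages of `k` combine with the same weights.
      by_contra! hno
      have h1 : ((-avg k a t - δ : ℝ) : EReal) < G (avg ψ a t) := by
        by_contra! hle1
        refine (hno (a, t) ⟨⟨ha, ht.1, ht.2.le.trans hb⟩, hseg (left_mem_segment ℝ _ _), hle1⟩
          le_rfl ht.2.le).not_gt ?_
        simp only
        linarith [ht.2]
      have h2 : ((-avg k t b - δ : ℝ) : EReal) < G (avg ψ t b) := by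
        by_contra! hle2
        refine (hno (t, b) ⟨⟨ha.trans ht.1.le, ht.2, hb⟩, hseg (right_mem_segment ℝ _ _), hle2⟩
          ht.1.le le_rfl).not_gt ?_
        simp only
        linarith [ht.1]
      obtain ⟨c₁, hc₁, hc₁'⟩ := EReal.lt_iff_exists_real_btwn.1 h1
      obtain ⟨c₂, hc₂, hc₂'⟩ := EReal.lt_iff_exists_real_btwn.1 h2
      rw [EReal.coe_lt_coe_iff] at hc₁ hc₂
      have hba := sub_pos.2 hab
      have hα : 0 < (t - a) / (b - a) := div_pos (sub_pos.2 ht.1) hba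
      have hβ : 0 < (b - t) / (b - a) := div_pos (sub_pos.2 ht.2) hba
      have hαβ : (t - a) / (b - a) + (b - t) / (b - a) = 1 := by
        rw [← add_div, div_eq_one_iff_eq hba.ne']
        ring
      have hconc := (hG.combo_le hseg hc₁'.le hc₂'.le hα.le hβ.le hαβ).trans
        (avg_eq_combo hψ ht.1 ht.2 ▸ hle)
      rw [EReal.coe_le_coe_iff, avg_eq_combo hk ht.1 ht.2] at hconc
      have h3 := mul_lt_mul_of_pos_left hc₁ hα
      have h4 := mul_lt_mul_of_pos_left hc₂ hβ
      have h5 : (t - a) / (b - a) * δ + (b - t) / (b - a) * δ = δ := by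
        rw [← add_mul, hαβ, one_mul]
      simp only [smul_eq_mul] at hconc
      linarith
    · refine ⟨⟨le_rfl, one_pos, le_rfl⟩, ⟨hclos 0 1 le_rfl one_pos le_rfl, hx⟩, ?_⟩
      refine hr1.le.trans (EReal.coe_le_coe_iff.2 ?_)
      simp only
      linarith
  have hx01 : x ∈ Icc (0 : ℝ) 1 := ⟨(huS 0).1.1.trans (hux 0).1, (hux 0).2.trans (huS 0).1.2.2⟩
  obtain ⟨η, hη, hb⟩ := hloc x
  have hkle : ∀ᶠ n in atTop, -avg k (u n).1 (u n).2 ≤ -φ' x := by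
    filter_upwards [hu1.eventually (lt_mem_nhds (sub_lt_self x hη)),
      hu2.eventually (gt_mem_nhds (lt_add_of_pos_right x hη))] with n h1 h2
    exact neg_le_neg (hb _ _ h1 (huS n).1.2.1 h2)
  by_cases hQ : IsAveragePoint ψ x
  · have hlim := hQ.tendsto hu1 hu2 (Eventually.of_forall fun n =>
      ⟨(hux n).1, (hux n).2, (huS n).1.2.1⟩)
    have hψx := hfr x hx01
    have hc : ((f (ψ x) - δ / 2 : ℝ) : EReal) < G (ψ x) := by
      rw [hGf _ hψx, EReal.coe_lt_coe_iff]
      linarith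
    have e1 := (tendsto_nhdsWithin_iff.2 ⟨hlim, Eventually.of_forall fun n =>
      (huS n).2.1⟩).eventually (h.lsc hd hG hmG hf hGf hψx.1 _ hc)
    obtain ⟨n, hn1, hn2⟩ := (e1.and hkle).exists
    have h1 := hn1.trans (huS n).2.2
    rw [EReal.coe_le_coe_iff] at h1
    simp only [φ', hQ, if_true, neg_neg] at hn2
    linarith [hφf x hx01]
  · obtain ⟨n, hn⟩ := hkle.exists
    have h1 := (hmG _ (huS n).2.1).trans (huS n).2.2
    rw [EReal.coe_le_coe_iff] at h1
    simp only [φ', hQ, if_false, neg_neg] at hn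
    linarith

end AdmissiblePair

end

/-! ### Removal of the truncation, and dimension at most one -/

section
theorem avg_eq_of_ae_eq {E : Type*} [NormedAddCommGroup E] [NormedSpace ℝ E] [CompleteSpace E]
    {ψ : ℝ → E} {z : E} {a b : ℝ} (hψ : Integrable ψ) (hab : a < b)
    (h : ∀ᵐ x, x ∈ Icc a b → ψ x = z) : avg ψ a b = z :=
  avg_mem hψ (S := {z}) (convex_singleton z) isClosed_singleton hab h

/-- Truncation at `N ≥ 0` leaves the negative part unchanged, and that part has finite integral
since `g ≥ m`; monotone convergence handles the positive part. -/
theorem extAverage_le {g : ℝ → ℝ} (hg : AEMeasurable g (volume.restrict (Icc 0 1))) {m : ℝ}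
    (hm : ∀ x ∈ Icc (0 : ℝ) 1, m ≤ g x) {X : EReal}
    (h : ∀ N : ℕ, ((∫ x in Icc (0 : ℝ) 1, min (g x) N : ℝ) : EReal) ≤ X) :
    extAverage g ≤ X := by
  induction X with
  | bot => exact absurd (h 0) (not_le.2 (EReal.bot_lt_coe _))
  | top => exact le_top
  | coe r =>
    simp only [EReal.coe_le_coe_iff] at h
    set μ := volume.restrict (Icc (0 : ℝ) 1) with hμ
    set B := ∫⁻ x, ENNReal.ofReal (-g x) ∂μ with hB
    have hBtop : B ≠ ⊤ := by
      have h1 : B ≤ ∫⁻ _, ENNReal.ofReal (-m) ∂μ :=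
        setLIntegral_mono' measurableSet_Icc fun x hx =>
          ENNReal.ofReal_le_ofReal (neg_le_neg (hm x hx))
      refine ne_top_of_le_ne_top ?_ h1
      simp [hμ]
    have hneg : ∀ (N : ℕ) (x : ℝ), ENNReal.ofReal (-min (g x) N) = ENNReal.ofReal (-g x) := by
      intro N x
      rcases le_total (g x) N with hx | hx
      · rw [min_eq_left hx]
      · have hN : (0 : ℝ) ≤ N := N.cast_nonneg
        rw [min_eq_right hx, ENNReal.ofReal_of_nonpos (by linarith),
          ENNReal.ofReal_of_nonpos (by linarith)]
    have hmeas : ∀ N : ℕ, AEMeasurable (fun x => min (g x) N) μ := fun N =>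
      hg.min aemeasurable_const
    have hint : ∀ N : ℕ, Integrable (fun x => min (g x) N) μ := by
      intro N
      refine Integrable.of_bound (hmeas N).aestronglyMeasurable (|m| + N) ?_
      refine (ae_restrict_iff' measurableSet_Icc).2 (Eventually.of_forall fun x hx => ?_)
      have hN : (0 : ℝ) ≤ N := N.cast_nonneg
      rw [Real.norm_eq_abs, abs_le]
      constructor
      · refine le_min ?_ ?_
        · linarith [hm x hx, neg_abs_le m]
        · linarith [abs_nonneg m]
      · exact (min_le_right _ _).trans (by linarith [abs_nonneg m])
    have hA : ∀ N : ℕ, ∫⁻ x, ENNReal.ofReal (min (g x) N) ∂μ ≤ ENNReal.ofReal (r + B.toReal) := by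
      intro N
      have h1 := integral_eq_lintegral_pos_part_sub_lintegral_neg_part (hint N)
      simp only [hneg] at h1
      have h2 := h N
      rw [h1] at h2
      have h3 : ∫⁻ x, ENNReal.ofReal (min (g x) N) ∂μ ≠ ⊤ :=
        (hint N).lintegral_lt_top.ne
      rw [← ENNReal.ofReal_toReal h3]
      exact ENNReal.ofReal_le_ofReal (by linarith)
    have hr : 0 ≤ r + B.toReal := by
      have h1 := integral_eq_lintegral_pos_part_sub_lintegral_neg_part (hint 0)
      simp only [hneg] at h1
      have h2 := h 0
      rw [h1] at h2
      have : 0 ≤ (∫⁻ x, ENNReal.ofReal (min (g x) (0 : ℕ)) ∂μ).toReal := ENNReal.toReal_nonneg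
      linarith
    have hlim : Tendsto (fun N : ℕ => ∫⁻ x, ENNReal.ofReal (min (g x) N) ∂μ) atTop
        (𝓝 (∫⁻ x, ENNReal.ofReal (g x) ∂μ)) := by
      refine lintegral_tendsto_of_tendsto_of_monotone (fun N => (hmeas N).ennreal_ofReal)
        (Eventually.of_forall fun x N M hNM => ?_) (Eventually.of_forall fun x => ?_)
      · exact ENNReal.ofReal_le_ofReal (min_le_min le_rfl (Nat.cast_le.2 hNM))
      · refine tendsto_const_nhds.congr' ?_
        obtain ⟨N₀, hN₀⟩ := exists_nat_ge (g x)
        filter_upwards [eventually_ge_atTop N₀] with N hN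
        rw [min_eq_left (hN₀.trans (Nat.cast_le.2 hN))]
    have hfin := le_of_tendsto' hlim hA
    have h1 : ((∫⁻ x, ENNReal.ofReal (g x) ∂μ : ENNReal) : EReal) ≤ ((r + B.toReal : ℝ) : EReal) := by
      have := EReal.coe_ennreal_le_coe_ennreal_iff.2 hfin
      rwa [EReal.coe_ennreal_ofReal, max_eq_left hr] at this
    have h2 : (B : EReal) = ((B.toReal : ℝ) : EReal) := by
      conv_lhs => rw [← ENNReal.ofReal_toReal hBtop]
      rw [EReal.coe_ennreal_ofReal, max_eq_left ENNReal.toReal_nonneg]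
    calc extAverage g ≤ ((r + B.toReal : ℝ) : EReal) - (B : EReal) := EReal.sub_le_sub h1 le_rfl
      _ = (r : EReal) := by rw [h2, ← EReal.coe_sub]; simp

theorem extAverage_const (c : ℝ) {g : ℝ → ℝ} (hg : ∀ᵐ x, x ∈ Icc (0 : ℝ) 1 → g x = c) :
    extAverage g ≤ c := by
  have hg' : g =ᵐ[volume.restrict (Icc 0 1)] fun _ => c :=
    (ae_restrict_iff' measurableSet_Icc).2 hg
  have e1 : ∫⁻ x in Icc (0 : ℝ) 1, ENNReal.ofReal (g x) =
      ∫⁻ _ in Icc (0 : ℝ) 1, ENNReal.ofReal c :=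
    lintegral_congr_ae (hg'.fun_comp ENNReal.ofReal)
  have e2 : ∫⁻ x in Icc (0 : ℝ) 1, ENNReal.ofReal (-g x) =
      ∫⁻ _ in Icc (0 : ℝ) 1, ENNReal.ofReal (-c) :=
    lintegral_congr_ae (hg'.fun_comp fun y => ENNReal.ofReal (-y))
  have h1 : extAverage g = extAverage fun _ => c := by
    rw [extAverage, extAverage, e1, e2]
  rw [h1]
  refine extAverage_le (m := c) aemeasurable_const (fun _ _ => le_rfl) fun N => ?_
  simp

variable {d : ℕ} {ΩO ΩI : Set (EuclideanSpace ℝ (Fin d))}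

namespace AdmissiblePair

theorem eq_zero_of_apply_eq_zero (hd : d < 2) {l : EuclideanSpace ℝ (Fin d) →L[ℝ] ℝ}
    (hl : l ≠ 0) {u : EuclideanSpace ℝ (Fin d)} (hu : l u = 0) : u = 0 := by
  obtain ⟨v, hv⟩ := finrank_le_one_iff.1
    (show Module.finrank ℝ (EuclideanSpace ℝ (Fin d)) ≤ 1 by simp; omega)
  obtain ⟨c, rfl⟩ := hv u
  rw [map_smul, smul_eq_mul] at hu
  rcases mul_eq_zero.1 hu with rfl | h0
  · simp
  · refine absurd (ContinuousLinearMap.ext fun w => ?_) hl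
    obtain ⟨c', rfl⟩ := hv w
    simp [h0]

/-- A supporting hyperplane is now a single point. If it missed `ΩI`, the hull would lie in the open
half-space and could not touch it. -/
theorem frontier_subset_inner (h : AdmissiblePair ΩO ΩI) (hd : d < 2) :
    frontier (convexHull ℝ ΩI) ⊆ ΩI := by
  intro p hp
  by_contra hpI
  obtain ⟨-, -, l, -, hl, hle, ⟨y, hy, hyp⟩, -⟩ := h.exists_facet hp hpI
  have hlt : convexHull ℝ ΩI ⊆ {w | l w < l p} := by
    refine convexHull_min (fun w hw => lt_of_le_of_ne
      (hle w (subset_closure (subset_convexHull ℝ ΩI hw))) fun he => hpI ?_)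
      (convex_halfSpace_lt l.isLinear _)
    rwa [← sub_eq_zero.1 (eq_zero_of_apply_eq_zero hd hl
      (show l (w - p) = 0 by rw [map_sub, he, sub_self]))]
  exact (hlt hy).ne hyp

/-- The average over `[0,1]` lies beyond an end `p ∈ ΩI` of the hull. Averages vary continuously
over the connected set of intervals and never equal `p`, so all lie beyond `p`, and so does `ψ`
almost everywhere. On that side `∂ΩO` has only one point. -/
theorem ae_eq_const (h : AdmissiblePair ΩO ΩI) (hd : d < 2)
    {ψ : ℝ → EuclideanSpace ℝ (Fin d)} (hψ : Integrable ψ)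
    (hfr : ∀ x ∈ Icc (0 : ℝ) 1, ψ x ∈ frontier ΩO)
    (havg : ∀ s t : ℝ, 0 ≤ s → s < t → t ≤ 1 → avg ψ s t ∉ ΩI)
    (hx : avg ψ 0 1 ∉ interior (convexHull ℝ ΩI)) :
    ∃ z ∈ frontier ΩO, ∀ᵐ x, x ∈ Icc (0 : ℝ) 1 → ψ x = z := by
  have hinj : ∀ {l : EuclideanSpace ℝ (Fin d) →L[ℝ] ℝ}, l ≠ 0 → ∀ {v w}, l v = l w → v = w :=
    fun hl v w he => sub_eq_zero.1 (eq_zero_of_apply_eq_zero hd hl (by rw [map_sub, he, sub_self]))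
  have hxC : avg ψ 0 1 ∉ closure (convexHull ℝ ΩI) := fun hc =>
    havg 0 1 le_rfl one_pos le_rfl (h.frontier_subset_inner hd ⟨hc, hx⟩)
  obtain ⟨l, p, hl, hp, hle, -, hlt⟩ :=
    exists_supporting_functional (convex_convexHull ℝ ΩI) h.nonempty_interior hx
  have hpI : p ∈ ΩI := h.frontier_subset_inner hd (h.mem_frontier_of_eq hl hle hp rfl)
  have hpO : p ∈ ΩO := h.inner_subset_outer hpI
  let D : Set (ℝ × ℝ) := {q | (0 ≤ q.1 ∧ q.1 < q.2) ∧ q.2 ≤ 1}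
  have hD : Convex ℝ D := by
    have h1 : Convex ℝ {q : ℝ × ℝ | 0 ≤ q.1} :=
      convex_halfSpace_ge (LinearMap.fst ℝ ℝ ℝ).isLinear 0
    have h2 : Convex ℝ {q : ℝ × ℝ | q.2 ≤ 1} :=
      convex_halfSpace_le (LinearMap.snd ℝ ℝ ℝ).isLinear 1
    have h3 : Convex ℝ {q : ℝ × ℝ | q.1 < q.2} := by
      have := convex_halfSpace_lt (LinearMap.fst ℝ ℝ ℝ - LinearMap.snd ℝ ℝ ℝ).isLinear 0
      simpa using this
    exact (h1.inter h3).inter h2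
  have hcont : ContinuousOn (fun q : ℝ × ℝ => l (avg ψ q.1 q.2)) D :=
    l.continuous.comp_continuousOn ((continuousOn_avg hψ).mono fun q hq => hq.1.2)
  have hgt : ∀ s t : ℝ, 0 ≤ s → s < t → t ≤ 1 → l p < l (avg ψ s t) := by
    intro s t hs hst ht
    by_contra! hcon
    obtain ⟨q, hq, hqp⟩ := hD.isPreconnected.intermediate_value (a := (s, t)) (b := (0, 1))
      ⟨⟨hs, hst⟩, ht⟩ ⟨⟨le_rfl, one_pos⟩, le_rfl⟩ hcont ⟨hcon, (hlt hxC).le⟩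
    exact havg q.1 q.2 hq.1.1 hq.1.2 hq.2 (hinj hl hqp ▸ hpI)
  have hge : ∀ᵐ x, x ∈ Icc (0 : ℝ) 1 → l p ≤ l (ψ x) := by
    have hne1 : ∀ᵐ x : ℝ, x ≠ 1 := by simp [ae_iff]
    filter_upwards [ae_isAveragePoint hψ, hne1] with x hx hx1 hx01
    have hx1' : x < 1 := lt_of_le_of_ne hx01.2 hx1
    have hlim : Tendsto (fun b => avg ψ x b) (𝓝[>] x) (𝓝 (ψ x)) := by
      refine hx.tendsto tendsto_const_nhds (tendsto_id.mono_right nhdsWithin_le_nhds) ?_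
      filter_upwards [self_mem_nhdsWithin] with b hb
      exact ⟨le_rfl, le_of_lt hb, hb⟩
    refine ge_of_tendsto ((l.continuous.tendsto _).comp hlim) ?_
    filter_upwards [Ioo_mem_nhdsGT hx1'] with b hb
    exact (hgt x b hx01.1 hb.1 hb.2.le).le
  have huniq : ∀ z₁ ∈ frontier ΩO, ∀ z₂ ∈ frontier ΩO, l p ≤ l z₁ → ¬ l z₁ < l z₂ := by
    intro z₁ h₁ z₂ h₂ hp₁ hlt
    have hO : ∀ z ∈ frontier ΩO, z ∉ ΩO := fun z hz hzO =>
      hz.2 (h.isOpen_outer.interior_eq.symm ▸ hzO)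
    have hp₁' : l p < l z₁ := lt_of_le_of_ne hp₁ fun he => hO z₁ h₁ (hinj hl he ▸ hpO)
    have hden : 0 < l z₂ - l p := by linarith
    have hs1 : (l z₂ - l z₁) / (l z₂ - l p) + (l z₁ - l p) / (l z₂ - l p) = 1 := by
      rw [← add_div, div_eq_one_iff_eq hden.ne']
      ring
    have hmem := h.convex_outer.combo_interior_closure_mem_interior
      (h.isOpen_outer.interior_eq.symm ▸ hpO) h₂.1
      (div_pos (sub_pos.2 hlt) hden) (div_pos (sub_pos.2 hp₁') hden).le hs1
    have heq : ((l z₂ - l z₁) / (l z₂ - l p)) • p + ((l z₁ - l p) / (l z₂ - l p)) • z₂ = z₁ := by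
      refine hinj hl ?_
      simp only [map_add, map_smul, smul_eq_mul]
      field_simp
      ring
    rw [heq] at hmem
    exact h₁.2 hmem
  obtain ⟨x₀, hx₀, hx₀p⟩ : ∃ x₀ ∈ Icc (0 : ℝ) 1, l p ≤ l (ψ x₀) := by
    by_contra! hcon
    have : ∀ᵐ x : ℝ, x ∉ Icc (0 : ℝ) 1 := by
      filter_upwards [hge] with x hx hx01
      exact (hcon x hx01).not_ge (hx hx01)
    have h0 := measure_eq_zero_iff_ae_notMem.2 this
    simp at h0
  refine ⟨ψ x₀, hfr x₀ hx₀, ?_⟩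
  filter_upwards [hge] with x hx hx01
  refine hinj hl (le_antisymm ?_ ?_)
  · exact not_lt.1 (huniq _ (hfr x₀ hx₀) _ (hfr x hx01) hx₀p)
  · exact not_lt.1 (huniq _ (hfr x hx01) _ (hfr x₀ hx₀) (hx hx01))

end AdmissiblePair

end

end Bellman

/-! ### The theorem -/

open Bellman

theorem mainTheorem1 {d : ℕ} (ΩO ΩI : Set (EuclideanSpace ℝ (Fin d)))
    (hΩ : Bellman.AdmissiblePair ΩO ΩI)
    (f : EuclideanSpace ℝ (Fin d) → ℝ)
    (hf_cont : ContinuousOn f (frontier ΩO))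
    (hf_bdd : BddBelow (f '' frontier ΩO))
    (ψ : ℝ → EuclideanSpace ℝ (Fin d))
    (hψ : Bellman.MemClassA ΩO ΩI ψ)
    (hψ_avg : (⨍ x in Set.Icc (0 : ℝ) 1, ψ x) ∉ interior (convexHull ℝ ΩI)) :
    ((⨍ x in Set.Icc (0 : ℝ) 1, ψ x) ∉ convexHull ℝ ΩI →
      Bellman.extAverage (fun x => f (ψ x)) ≤
        Bellman.minLocallyConcave ΩO (closure ΩO \ convexHull ℝ ΩI) f
          (⨍ x in Set.Icc (0 : ℝ) 1, ψ x)) ∧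
    Bellman.extAverage (fun x => f (ψ x)) ≤
      Bellman.minLocallyConcave ΩO (closure ΩO \ interior (convexHull ℝ ΩI)) f
        (⨍ x in Set.Icc (0 : ℝ) 1, ψ x) := by
  -- Extension by zero makes the function integrable on the whole line without changing averages
  -- inside `[0,1]`.
  let ψ' : ℝ → EuclideanSpace ℝ (Fin d) := (Icc (0 : ℝ) 1).indicator ψ
  have hψ'eq : ∀ x ∈ Icc (0 : ℝ) 1, ψ' x = ψ x := fun x hx => indicator_of_mem hx ψ
  have hint : Integrable ψ' := hψ.integrableOn.integrable_indicator measurableSet_Icc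
  have havgeq : ∀ a b : ℝ, 0 ≤ a → a < b → b ≤ 1 → ⨍ x in Icc a b, ψ x = avg ψ' a b := by
    intro a b ha hab hb
    rw [setAverage_Icc_eq_avg ψ hab.le]
    exact avg_congr hab.le fun x hx => (hψ'eq x ⟨ha.trans hx.1, hx.2.trans hb⟩).symm
  have hfr : ∀ x ∈ Icc (0 : ℝ) 1, ψ' x ∈ frontier ΩO := fun x hx => by
    rw [hψ'eq x hx]
    exact hψ.mem_frontier x hx
  have havg : ∀ s t : ℝ, 0 ≤ s → s < t → t ≤ 1 → avg ψ' s t ∉ ΩI := fun s t hs hst ht => by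
    rw [← havgeq s t hs hst ht]
    exact hψ.average_notMem s t hs hst ht
  rw [havgeq 0 1 le_rfl one_pos le_rfl] at hψ_avg ⊢
  rcases lt_or_ge d 2 with hd | hd
  · obtain ⟨z, hz, hae⟩ := hΩ.ae_eq_const hd hint hfr havg hψ_avg
    have hconst : extAverage (fun x => f (ψ x)) ≤ f z := by
      refine extAverage_const (f z) ?_
      filter_upwards [hae] with x hx hx01
      rw [← hψ'eq x hx01, hx hx01]
    rw [avg_eq_of_ae_eq hint one_pos hae]
    have hmin : ∀ W, (f z : EReal) ≤ minLocallyConcave ΩO W f z := fun W => by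
      refine le_sInf ?_
      rintro _ ⟨G, -, hGf, rfl⟩
      exact (hGf z hz).ge
    exact ⟨fun _ => hconst.trans (hmin _), hconst.trans (hmin _)⟩
  have hsecond : extAverage (fun x => f (ψ x)) ≤
      minLocallyConcave ΩO (closure ΩO \ interior (convexHull ℝ ΩI)) f (avg ψ' 0 1) := by
    obtain ⟨m, hm⟩ := hf_bdd
    have hmf : ∀ z ∈ frontier ΩO, m ≤ f z := fun z hz => hm (mem_image_of_mem f hz)
    refine le_sInf ?_
    rintro _ ⟨G, hG, hGf, rfl⟩
    classical
    have hmeas : AEMeasurable (fun x => f (ψ x)) (volume.restrict (Icc 0 1)) := by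
      have h1 : Measurable ((frontier ΩO).piecewise f 0) :=
        hf_cont.measurable_piecewise continuousOn_const isClosed_frontier.measurableSet
      refine (h1.comp_aemeasurable hψ.integrableOn.aestronglyMeasurable.aemeasurable).congr ?_
      refine (ae_restrict_iff' measurableSet_Icc).2 (Eventually.of_forall fun x hx => ?_)
      exact piecewise_eq_of_mem _ _ _ (hψ.mem_frontier x hx)
    refine extAverage_le hmeas (m := m) (fun x hx => hmf _ (hψ.mem_frontier x hx)) fun N => ?_
    have hintN : IntegrableOn (fun x => min (f (ψ x)) N) (Icc 0 1) := by
      refine Integrable.of_bound (hmeas.min aemeasurable_const).aestronglyMeasurable (|m| + N) ?_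
      refine (ae_restrict_iff' measurableSet_Icc).2 (Eventually.of_forall fun x hx => ?_)
      have hN : (0 : ℝ) ≤ N := N.cast_nonneg
      rw [Real.norm_eq_abs, abs_le]
      constructor
      · refine le_min ?_ ?_
        · linarith [hmf _ (hψ.mem_frontier x hx), neg_abs_le m]
        · linarith [abs_nonneg m]
      · exact (min_le_right _ _).trans (by linarith [abs_nonneg m])
    have hmain := hΩ.integral_le hd hG hf_cont hGf hmf hint hfr havg hψ_avg
      (hintN.integrable_indicator measurableSet_Icc) fun x hx => by
        rw [indicator_of_mem hx, hψ'eq x hx]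
        exact min_le_left _ _
    convert hmain using 2
    rw [intervalIntegral.integral_of_le zero_le_one, ← integral_Icc_eq_integral_Ioc]
    exact setIntegral_congr_fun measurableSet_Icc fun x hx =>
      (indicator_of_mem hx (fun x => min (f (ψ x)) (N : ℝ))).symm
  exact ⟨fun hxC => hsecond.trans (hΩ.minLocallyConcave_le hd hf_bdd hxC), hsecond⟩
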